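/- Let $m\ge 2$, let $D^m=[0,1]^m$ and let $\Phi:D^m\to D^m$ be continuous. A *box* is a compact subset of $D^m$ homeomorphic to $D^m$. For boxes $B,C\subset\operatorname{int}(D^m)$ write $B\to C$ if $\Phi(B)\cap\operatorname{int}(C)\neq\emptyset$. Call $\Phi$ a *model* with atoms $(\mathcal A_n)_{n\ge 0}$ if $\Phi(D^m)\subset\operatorname{int}(D^m)$, each $\mathcal A_n$ is a finite family of pairwise disjoint boxes contained in $\operatorname{int}(D^m)$ (the *atoms of generation $n$*, or *$n$-atoms*), $\max_{A\in\mathcal A_n}\operatorname{diam}A\to 0$ as $n\to\infty$, and the following holds. * $\mathcal A_0=\{A\}$ with $A\to A$; $\mathcal A_1$ consists of two boxes contained in $\operatorname{int}(A)$, and $B\to C$ for all $B,C\in\mathcal A_1$. * For every $n\ge 2$: (a) each $n$-atom is contained in the interior of some $(n-1)$-atom, and for each $B\in\mathcal A_{n-1}$ the collection $\Omega_n(B)=\{G\in\mathcal A_n: G\subset\operatorname{int}(B)\}$ of children of $B$ has exactly $2^n\cdot 2^{n-1}$ elements. Moreover there are collections $\Omega_n(D,B)$ and $\Gamma_n(D,B,C)$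 of $n$-atoms, for $D,B,C\in\mathcal A_{n-1}$ with $D\to B\to C$, such that (b) for each $B\in\mathcal A_{n-1}$, $\Omega_n(B)$ is the disjoint union of the collections $\Omega_n(D,B)$ over all $D\in\mathcal A_{n-1}$ with $D\to B$, and each of these has $2^n$ elements; (c) for all $D,B\in\mathcal A_{n-1}$ with $D\to B$, $\Omega_n(D,B)$ is the disjoint union of the collections $\Gamma_n(D,B,C)$ over all $C\in\mathcal A_{n-1}$ with $B\to C$, and each of these has $2$ elements; (d) if $D,B,C\in\mathcal A_{n-1}$, $D\to B$, $B\to C$ and $G\in\Gamma_n(D,B,C)$, then $G\to E$ for every $E\in\Omega_n(B,C)$, and $\Phi(G)\cap E'=\emptyset$ for every $E'\in\mathcal A_n\setminus\Omega_n(B,C)$. (It follows that $\#\mathcal A_n=2^{n^2}$ and that every $n$-atom $G$ with $n\ge1$ satisfies $\#\{E\in\mathcal A_n:G\to E\}=\#\{E\in\mathcal A_n:E\to G\}=2^n$.) **Main Lemma.** Let $\Phi$ be a model with atoms $(\mathcal A_n)_{n\ge0}$. Then $\Lambda:=\bigcap_{n\ge 0}\bigcup_{A\in\mathcal A_n}A$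 is a Cantor set (nonempty, compact, perfect and totally disconnected) with $\Phi(\Lambda)=\Lambda$, and there is a $\Phi$-invariant, mixing (hence ergodic) Borel probability measure $\nu$ on $D^m$ with $\nu(\Lambda)=1$ and infinite metric entropy, $h_\nu(\Phi)=+\infty$. Moreover, for every $n\ge0$ the sets $A\cap\Lambda$, $A\in\mathcal A_n$, form a finite measurable partition up to a $\nu$-null set, which is again denoted $\mathcal A_n$, and $$h(\mathcal A_n,\nu)=\lim_{l\to\infty}\frac1l\,H\Big(\bigvee_{j=0}^{l-1}\Phi^{-j}\mathcal A_n,\ \nu\Big)=n\log 2 .$$ Here $H(\mathcal Q,\nu)=-\sum_{X\in\mathcal Q}\nu(X)\log\nu(X)$, and $h_\nu(\Phi)$ is the supremum of $h(\mathcal P,\nu)$ over all finite measurable partitions $\mathcal P$ (up to $\nu$-null sets). -/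

import Mathlib

open Set Filter MeasureTheory Topology

/-- The cube `[0,1]^m`, as a subset of Euclidean space. -/
def unitCube (m : ℕ) : Set (EuclideanSpace ℝ (Fin m)) :=
  {x | ∀ i, x i ∈ Set.Icc (0 : ℝ) 1}

/-- The cube `D^m = [0,1]^m` as a metric and Borel space of its own. -/
abbrev Cube (m : ℕ) : Type := ↥(unitCube m)

/-- The interior `int (D^m)` (taken in Euclidean space) as a set of points of `D^m`. -/
def cubeInterior (m : ℕ) : Set (Cube m) := Subtype.val ⁻¹' interior (unitCube m)

/-- A box: a compact subset of `D^m` that is homeomorphic to `D^m`. -/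
def IsBox {m : ℕ} (K : Set (Cube m)) : Prop :=
  IsCompact K ∧ Nonempty (↥K ≃ₜ Cube m)

/-- The relation `B → C` from a box to another: `Φ(B) ∩ int(C) ≠ ∅`. For the boxes in `int (D^m)`
the interior relative to `D^m` is the interior in Euclidean space. -/
def Arrow {m : ℕ} (Φ : C(Cube m, Cube m)) (B C : Set (Cube m)) : Prop :=
  ((Φ '' B) ∩ interior C).Nonempty

/-- The members of the family `𝒩` that lie in the interior of `B` (the children of `B`). -/
def childrenIn {m : ℕ} (𝒩 : Finset (Set (Cube m))) (B : Set (Cube m)) : Set (Set (Cube m)) :=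
  {G | G ∈ 𝒩 ∧ G ⊆ interior B}

/-- Conditions a), b), c), d) that make `𝒩` a family of atoms of generation `n + 1`,
where `𝒬` is the family of atoms of generation `n` (used for `n ≥ 1`). -/
structure IsNextGeneration {m : ℕ} (Φ : C(Cube m, Cube m)) (n : ℕ)
    (𝒬 𝒩 : Finset (Set (Cube m))) : Prop where
  /-- a) every new atom lies in the interior of an old one. -/
  subset_parent : ∀ G ∈ 𝒩, ∃ B ∈ 𝒬, G ⊆ interior B
  /-- a) every old atom has exactly `2^(n+1) * 2^n` children. -/
  card_children : ∀ B ∈ 𝒬, (childrenIn 𝒩 B).ncard = 2 ^ (n + 1) * 2 ^ n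
  /-- b), c), d): the sub-collections `Ω D B` and `Γ D B C` of children of `B`. -/
  exists_subcollections :
    ∃ (Ω : Set (Cube m) → Set (Cube m) → Set (Set (Cube m)))
      (Γ : Set (Cube m) → Set (Cube m) → Set (Cube m) → Set (Set (Cube m))),
      -- b) the children of `B` are partitioned into the `Ω D B` with `D → B`
      (∀ B ∈ 𝒬, (⋃ D ∈ {D | D ∈ 𝒬 ∧ Arrow Φ D B}, Ω D B) = childrenIn 𝒩 B) ∧
      (∀ B ∈ 𝒬, {D | D ∈ 𝒬 ∧ Arrow Φ D B}.PairwiseDisjoint (fun D => Ω D B)) ∧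
      (∀ D ∈ 𝒬, ∀ B ∈ 𝒬, Arrow Φ D B → (Ω D B).ncard = 2 ^ (n + 1)) ∧
      -- c) each `Ω D B` is partitioned into the `Γ D B C` with `B → C`
      (∀ D ∈ 𝒬, ∀ B ∈ 𝒬, Arrow Φ D B →
        (⋃ C ∈ {C | C ∈ 𝒬 ∧ Arrow Φ B C}, Γ D B C) = Ω D B) ∧
      (∀ D ∈ 𝒬, ∀ B ∈ 𝒬, Arrow Φ D B →
        {C | C ∈ 𝒬 ∧ Arrow Φ B C}.PairwiseDisjoint (fun C => Γ D B C)) ∧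
      (∀ D ∈ 𝒬, ∀ B ∈ 𝒬, ∀ C ∈ 𝒬, Arrow Φ D B → Arrow Φ B C → (Γ D B C).ncard = 2) ∧
      -- d) the images of the atoms of `Γ D B C` reach all of `Ω B C` and no other new atom
      (∀ D ∈ 𝒬, ∀ B ∈ 𝒬, ∀ C ∈ 𝒬, Arrow Φ D B → Arrow Φ B C → ∀ G ∈ Γ D B C,
        (∀ E ∈ Ω B C, Arrow Φ G E) ∧
        (∀ E' ∈ 𝒩, E' ∉ Ω B C → (Φ '' G) ∩ E' = ∅))

/-- `Φ` is a model map, with `𝒜 n` as its family of atoms of generation `n`, for every `n`. -/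
structure IsModelWith {m : ℕ} (Φ : C(Cube m, Cube m)) (𝒜 : ℕ → Finset (Set (Cube m))) :
    Prop where
  range_subset : Set.range Φ ⊆ cubeInterior m
  isBox : ∀ n, ∀ A ∈ 𝒜 n, IsBox A
  subset_interior : ∀ n, ∀ A ∈ 𝒜 n, A ⊆ cubeInterior m
  disjoint : ∀ n, ∀ A ∈ 𝒜 n, ∀ B ∈ 𝒜 n, A ≠ B → Disjoint A B
  gen_zero : ∃ A, 𝒜 0 = {A} ∧ Arrow Φ A A
  gen_one_card : (𝒜 1).card = 2
  gen_one_subset : ∀ A ∈ 𝒜 0, ∀ B ∈ 𝒜 1, B ⊆ interior A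
  gen_one_arrow : ∀ B ∈ 𝒜 1, ∀ C ∈ 𝒜 1, Arrow Φ B C
  gen_succ : ∀ n, 1 ≤ n → IsNextGeneration Φ n (𝒜 n) (𝒜 (n + 1))
  tendsto_diam : Tendsto (fun n => ⨆ A ∈ 𝒜 n, Metric.ediam A) atTop (𝓝 0)

/-- The `Λ`-set: the points that lie in an atom of every generation. -/
def lambdaSet {m : ℕ} (𝒜 : ℕ → Finset (Set (Cube m))) : Set (Cube m) :=
  ⋂ n, ⋃ A ∈ 𝒜 n, A

/-- A Cantor set in a metric space: nonempty, compact, without isolated points, and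
totally disconnected. -/
def IsCantorSet {X : Type*} [MetricSpace X] (K : Set X) : Prop :=
  K.Nonempty ∧ IsCompact K ∧ Perfect K ∧ IsTotallyDisconnected K

section Entropy

variable {X : Type*} [MeasurableSpace X]

/-- Mixing: `ν(T^{-l}(D) ∩ C) → ν(D) ν(C)` for all measurable `C`, `D`. -/
def IsMixing (T : X → X) (ν : Measure X) : Prop :=
  ∀ C D : Set X, MeasurableSet C → MeasurableSet D →
    Tendsto (fun l : ℕ => ν ((T^[l] ⁻¹' D) ∩ C)) atTop (𝓝 (ν D * ν C))

/-- A finite measurable partition of `X` up to a `ν`-null set, as a family of disjoint sets. -/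
structure IsFinitePartition {ι : Type*} (ν : Measure X) (P : ι → Set X) : Prop where
  finite : Finite ι
  measurableSet : ∀ i, MeasurableSet (P i)
  disjoint : ∀ i j, i ≠ j → Disjoint (P i) (P j)
  cover : ν (⋃ i, P i)ᶜ = 0

/-- The entropy `H(⋁_{j<l} T^{-j} P, ν) = -∑ ν(Q) log ν(Q)` of the `l`-fold join of `P`;
the sum is over all words `w`, and empty cells contribute `0`. -/
noncomputable def joinEntropy {ι : Type*} [Fintype ι] (T : X → X) (ν : Measure X)
    (P : ι → Set X) (l : ℕ) : ℝ :=
  ∑ w : Fin l → ι, Real.negMulLog (ν.real (⋂ j : Fin l, T^[(j : ℕ)] ⁻¹' P (w j)))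

/-- `h(P, ν) = lim (1/l) H(⋁_{j<l} T^{-j} P, ν)`; the limit exists for every finite partition and
every invariant probability measure, and is then the upper limit. -/
noncomputable def partitionEntropy {ι : Type*} [Fintype ι] (T : X → X) (ν : Measure X)
    (P : ι → Set X) : EReal :=
  limsup (fun l : ℕ => ((joinEntropy T ν P l / (l : ℝ) : ℝ) : EReal)) atTop

/-- The metric entropy `h_ν(T)`: the supremum of `h(P, ν)` over all finite partitions `P`. -/
noncomputable def metricEntropy (T : X → X) (ν : Measure X) : EReal :=
  ⨆ (k : ℕ) (P : Fin k → Set X) (_ : IsFinitePartition ν P), partitionEntropy T ν P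

end Entropy

/-- The partition of the `Λ`-set into its intersections with the atoms of generation `n`. -/
def atomPartition {m : ℕ} (𝒜 : ℕ → Finset (Set (Cube m))) (n : ℕ) :
    {A // A ∈ 𝒜 n} → Set (Cube m) :=
  fun A => A.1 ∩ lambdaSet 𝒜

/-- A nested sequence of finite families of pairwise disjoint closed cells in a metric space,
together with the transition relation `rel` that a continuous map `Φ` induces on each family.
A cell `G` of generation `n + 1` is labelled by a path `prev G → par G → next G` of generation `n`:
it lies in `par G`, is reached from `prev G` only and is mapped to `next G` only. -/
structure AtomTower {X : Type*} [MetricSpace X] (Φ : C(X, X)) (V : ℕ → Type*)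
    [∀ n, Fintype (V n)] where
  cell : ∀ {n : ℕ}, V n → Set X
  rel : ∀ {n : ℕ}, V n → V n → Prop
  prev : ∀ {n : ℕ}, V (n + 1) → V n
  par : ∀ {n : ℕ}, V (n + 1) → V n
  next : ∀ {n : ℕ}, V (n + 1) → V n
  root : V 0
  eq_root : ∀ v : V 0, v = root
  rel_root : rel root root
  isClosed_cell : ∀ {n : ℕ} (v : V n), IsClosed (cell v)
  nonempty_cell : ∀ {n : ℕ} (v : V n), (cell v).Nonempty
  disjoint_cell : ∀ {n : ℕ} {v w : V n}, v ≠ w → Disjoint (cell v) (cell w)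
  cell_subset : ∀ {n : ℕ} (v : V (n + 1)), cell v ⊆ cell (par v)
  rel_prev_par : ∀ {n : ℕ} (v : V (n + 1)), rel (prev v) (par v)
  rel_par_next : ∀ {n : ℕ} (v : V (n + 1)), rel (par v) (next v)
  ncard_fiber : ∀ {n : ℕ} {d b c : V n}, rel d b → rel b c →
    {g : V (n + 1) | prev g = d ∧ par g = b ∧ next g = c}.ncard = 2
  rel_iff : ∀ {n : ℕ} (g e : V (n + 1)), rel g e ↔ par g = prev e ∧ next g = par e
  image_inter_nonempty : ∀ {n : ℕ} {v w : V n}, rel v w → (Φ '' cell v ∩ cell w).Nonempty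
  image_inter_eq_empty : ∀ {n : ℕ} {v w : V n}, ¬ rel v w → Φ '' cell v ∩ cell w = ∅
  exists_dist_lt : ∀ ε > 0, ∃ N, ∀ n ≥ N, ∀ v : V n, ∀ x ∈ cell v, ∀ y ∈ cell v, dist x y < ε

namespace AtomTower

section Combinatorics

open scoped Classical

variable {X : Type*} [MetricSpace X] {Φ : C(X, X)} {V : ℕ → Type*} [∀ n, Fintype (V n)]
  (T : AtomTower Φ V)

theorem card_fiber {n : ℕ} {d b c : V n} (hd : T.rel d b) (hc : T.rel b c) :
    (Finset.univ.filter fun g => T.prev g = d ∧ T.par g = b ∧ T.next g = c).card = 2 := by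
  rw [← T.ncard_fiber hd hc, Set.ncard_eq_toFinset_card']
  congr 1
  ext g
  simp

theorem card_par_next {n : ℕ} {b c : V n} (hc : T.rel b c) :
    (Finset.univ.filter fun g => T.par g = b ∧ T.next g = c).card =
      (Finset.univ.filter fun d => T.rel d b).card * 2 := by
  rw [Finset.card_eq_sum_card_fiberwise (f := T.prev)
    (t := Finset.univ.filter fun d => T.rel d b)]
  · rw [← smul_eq_mul, ← Finset.sum_const]
    refine Finset.sum_congr rfl fun d hd => ?_
    rw [Finset.filter_filter, ← T.card_fiber (by simpa using hd) hc]
    congr 1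
    ext g
    simp only [Finset.mem_filter, Finset.mem_univ, true_and]
    tauto
  · intro g hg
    obtain ⟨rfl, -⟩ : T.par g = b ∧ T.next g = c := by simpa using hg
    simpa using T.rel_prev_par g

theorem card_prev_par {n : ℕ} {d b : V n} (hd : T.rel d b) :
    (Finset.univ.filter fun g => T.prev g = d ∧ T.par g = b).card =
      (Finset.univ.filter fun c => T.rel b c).card * 2 := by
  rw [Finset.card_eq_sum_card_fiberwise (f := T.next)
    (t := Finset.univ.filter fun c => T.rel b c)]
  · rw [← smul_eq_mul, ← Finset.sum_const]
    refine Finset.sum_congr rfl fun c hc => ?_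
    rw [Finset.filter_filter, ← T.card_fiber hd (by simpa using hc)]
    congr 1
    ext g
    simp only [Finset.mem_filter, Finset.mem_univ, true_and]
    tauto
  · intro g hg
    obtain ⟨-, rfl⟩ : T.prev g = d ∧ T.par g = b := by simpa using hg
    simpa using T.rel_par_next g

theorem filter_root {p : V 0 → Prop} [DecidablePred p] (h : p T.root) :
    (Finset.univ.filter p).card = 1 := by
  rw [Finset.card_eq_one]
  refine ⟨T.root, ?_⟩
  ext v
  rw [T.eq_root v]
  simpa using h

/-- The in-degree of a cell of generation `n` is `2 ^ n`. -/
theorem card_rel_left {n : ℕ} (b : V n) :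
    (Finset.univ.filter fun d => T.rel d b).card = 2 ^ n := by
  induction n with
  | zero =>
    rw [T.eq_root b]
    exact T.filter_root T.rel_root
  | succ n ih =>
    rw [pow_succ, ← ih (T.prev b), ← T.card_par_next (T.rel_prev_par b)]
    congr 1
    ext g
    simp [T.rel_iff]

/-- The out-degree of a cell of generation `n` is `2 ^ n`. -/
theorem card_rel_right {n : ℕ} (b : V n) :
    (Finset.univ.filter fun c => T.rel b c).card = 2 ^ n := by
  induction n with
  | zero =>
    rw [T.eq_root b]
    exact T.filter_root T.rel_root
  | succ n ih =>
    rw [pow_succ, ← ih (T.next b), ← T.card_prev_par (T.rel_par_next b)]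
    congr 1
    ext g
    simp [T.rel_iff, eq_comm]

theorem exists_rel {n : ℕ} (b : V n) : ∃ c, T.rel b c := by
  have h : 0 < (Finset.univ.filter fun c => T.rel b c).card := by
    rw [T.card_rel_right]; positivity
  obtain ⟨c, hc⟩ := Finset.card_pos.1 h
  exact ⟨c, by simpa using hc⟩

theorem exists_rel_left {n : ℕ} (b : V n) : ∃ d, T.rel d b := by
  have h : 0 < (Finset.univ.filter fun d => T.rel d b).card := by
    rw [T.card_rel_left]; positivity
  obtain ⟨c, hc⟩ := Finset.card_pos.1 h
  exact ⟨c, by simpa using hc⟩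

/-- The number of children of a cell of generation `n`. -/
theorem card_par {n : ℕ} (b : V n) :
    (Finset.univ.filter fun g => T.par g = b).card = 2 ^ (2 * n + 1) := by
  rw [Finset.card_eq_sum_card_fiberwise (f := T.next)
    (t := Finset.univ.filter fun c => T.rel b c)]
  · have : ∀ c ∈ Finset.univ.filter (fun c => T.rel b c),
        ((Finset.univ.filter fun g => T.par g = b).filter fun g => T.next g = c).card
          = 2 ^ n * 2 := by
      intro c hc
      rw [Finset.filter_filter, T.card_par_next (by simpa using hc), T.card_rel_left]
    rw [Finset.sum_congr rfl this, Finset.sum_const, T.card_rel_right, smul_eq_mul]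
    ring
  · intro g hg
    obtain rfl : T.par g = b := by simpa using hg
    simpa using T.rel_par_next g

/-- The ancestor of generation `n` of a cell of generation `n + k`. -/
def anc {n : ℕ} : (k : ℕ) → V (n + k) → V n
  | 0, v => v
  | k + 1, v => anc k (T.par v)

theorem cell_subset_anc {n : ℕ} (k : ℕ) (v : V (n + k)) : T.cell v ⊆ T.cell (T.anc k v) := by
  induction k with
  | zero => exact subset_rfl
  | succ k ih => exact (T.cell_subset v).trans (ih (T.par v))

theorem card_anc {n : ℕ} (k : ℕ) (u : V n) :
    (Finset.univ.filter fun v : V (n + k) => T.anc k v = u).card * 2 ^ (n ^ 2)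
      = 2 ^ ((n + k) ^ 2) := by
  induction k with
  | zero =>
    have : (Finset.univ.filter fun v : V (n + 0) => T.anc 0 v = u) = {u} := by
      ext v
      exact Finset.mem_filter.trans ((and_iff_right (Finset.mem_univ _)).trans
        Finset.mem_singleton.symm)
    rw [this]
    simp
  | succ k ih =>
    rw [Finset.card_eq_sum_card_fiberwise (f := T.par)
      (t := Finset.univ.filter fun v : V (n + k) => T.anc k v = u)]
    · have : ∀ c ∈ Finset.univ.filter (fun v : V (n + k) => T.anc k v = u),
          ((Finset.univ.filter fun v : V (n + (k + 1)) => T.anc (k + 1) v = u).filter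
            fun g => T.par g = c).card = 2 ^ (2 * (n + k) + 1) := by
        intro c hc
        rw [← T.card_par c, Finset.filter_filter]
        congr 1
        ext g
        have hc' : T.anc k c = u := by simpa using hc
        constructor
        · exact fun h => Finset.mem_filter.2 ⟨Finset.mem_univ _, (Finset.mem_filter.1 h).2.2⟩
        · intro h
          obtain rfl : T.par g = c := (Finset.mem_filter.1 h).2
          exact Finset.mem_filter.2 ⟨Finset.mem_univ _, hc', rfl⟩
      rw [Finset.sum_congr rfl this, Finset.sum_const, smul_eq_mul, mul_right_comm, ih, ← pow_add]
      congr 1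
      ring
    · intro g hg
      exact Finset.mem_filter.2 ⟨Finset.mem_univ _, (Finset.mem_filter.1 hg).2⟩

theorem card_generation (T : AtomTower Φ V) (n : ℕ) : Fintype.card (V n) = 2 ^ (n ^ 2) := by
  induction n with
  | zero =>
    have := T.filter_root (p := fun _ => True) trivial
    simpa using this
  | succ n ih =>
    rw [← Finset.card_univ, Finset.card_eq_sum_card_fiberwise (f := T.par) (t := Finset.univ)
      (fun _ _ => by simp), Finset.sum_congr rfl fun b _ => T.card_par b]
    rw [Finset.sum_const, smul_eq_mul, Finset.card_univ, ih, ← pow_add]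
    congr 1
    ring

end Combinatorics

end AtomTower

namespace AtomTower

section LimitSet

open scoped Classical

variable {X : Type*} [MetricSpace X] {Φ : C(X, X)} {V : ℕ → Type*} [∀ n, Fintype (V n)]
  (T : AtomTower Φ V)

/-- The points that lie in a cell of every generation. -/
def limitSet : Set X := ⋂ n, ⋃ v : V n, T.cell v

theorem mem_limitSet {x : X} : x ∈ T.limitSet ↔ ∀ n, ∃ v : V n, x ∈ T.cell v := by
  simp [limitSet]

theorem eq_of_mem_cell {n : ℕ} {v w : V n} {x : X} (hv : x ∈ T.cell v) (hw : x ∈ T.cell w) :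
    v = w := by
  by_contra h
  exact Set.disjoint_left.1 (T.disjoint_cell h) hv hw

theorem isClosed_limitSet : IsClosed T.limitSet :=
  isClosed_iInter fun _ => isClosed_iUnion_of_finite fun v => T.isClosed_cell v

theorem exists_par_eq {n : ℕ} (v : V n) : ∃ g, T.par g = v := by
  have h : 0 < (Finset.univ.filter fun g => T.par g = v).card := by
    rw [T.card_par]; positivity
  obtain ⟨c, hc⟩ := Finset.card_pos.1 h
  exact ⟨c, by simpa using hc⟩

theorem exists_par_eq_ne {n : ℕ} (v : V n) (e : V (n + 1)) : ∃ g, T.par g = v ∧ g ≠ e := by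
  have h : 1 < (Finset.univ.filter fun g => T.par g = v).card := by
    rw [T.card_par]
    exact Nat.one_lt_two_pow (by omega)
  obtain ⟨c, hc, hne⟩ := Finset.exists_mem_ne h e
  exact ⟨c, by simpa using hc, hne⟩

theorem nonempty_generation (T : AtomTower Φ V) (n : ℕ) : Nonempty (V n) := by
  rw [← Fintype.card_pos_iff, T.card_generation]
  positivity

theorem cell_inter_limitSet_nonempty [CompactSpace X] {n : ℕ} (v : V n) :
    (T.cell v ∩ T.limitSet).Nonempty := by
  choose ch hch using fun {k : ℕ} (u : V k) => T.exists_par_eq u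
  let c : ∀ k, V (n + k) := fun k => Nat.rec v (fun _ u => ch u) k
  have hc : ∀ k, T.par (c (k + 1)) = c k := fun k => hch (c k)
  obtain ⟨x, hx⟩ := IsCompact.nonempty_iInter_of_sequence_nonempty_isCompact_isClosed
    (fun k => T.cell (c k)) (fun k => (T.cell_subset (c (k + 1))).trans (by rw [hc k]))
    (fun k => T.nonempty_cell _) (T.isClosed_cell _).isCompact (fun k => T.isClosed_cell _)
  rw [mem_iInter] at hx
  refine ⟨x, hx 0, T.mem_limitSet.2 fun j => ?_⟩
  have key : ∀ k (w : V (j + k)), x ∈ T.cell w → ∃ u : V j, x ∈ T.cell u :=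
    fun k w hw => ⟨_, T.cell_subset_anc k w hw⟩
  have hcj := hx j
  revert hcj
  generalize c j = w
  revert w
  rw [Nat.add_comm n j]
  exact fun w hw => key n w hw

theorem limitSet_nonempty [CompactSpace X] : T.limitSet.Nonempty :=
  (T.cell_inter_limitSet_nonempty T.root).mono inter_subset_right

theorem isPreconnected_subset_cell {n : ℕ} {t : Set X} (ht : IsPreconnected t)
    (hsub : t ⊆ T.limitSet) {v : V n} {x y : X} (hx : x ∈ t) (hy : y ∈ t)
    (hxv : x ∈ T.cell v) : y ∈ T.cell v := by
  by_contra hyv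
  have hB : IsClosed (⋃ w : {w : V n // w ≠ v}, T.cell w.1) :=
    isClosed_iUnion_of_finite fun w => T.isClosed_cell w.1
  have hcov : t ⊆ T.cell v ∪ ⋃ w : {w : V n // w ≠ v}, T.cell w.1 := by
    intro z hz
    obtain ⟨w, hw⟩ := T.mem_limitSet.1 (hsub hz) n
    by_cases h : w = v
    · exact Or.inl (h ▸ hw)
    · exact Or.inr (mem_iUnion.2 ⟨⟨w, h⟩, hw⟩)
  obtain ⟨z, -, hz1, hz2⟩ := isPreconnected_closed_iff.1 ht _ _ (T.isClosed_cell v) hB hcov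
    ⟨x, hx, hxv⟩ ⟨y, hy, (hcov hy).resolve_left hyv⟩
  obtain ⟨w, hw⟩ := mem_iUnion.1 hz2
  exact w.2 (T.eq_of_mem_cell hw hz1)

theorem isCantorSet_limitSet [CompactSpace X] : IsCantorSet T.limitSet := by
  refine ⟨T.limitSet_nonempty, T.isClosed_limitSet.isCompact, ⟨T.isClosed_limitSet, ?_⟩, ?_⟩
  · intro x hx
    rw [accPt_iff_nhds]
    intro U hU
    obtain ⟨ε, hε, hball⟩ := Metric.mem_nhds_iff.1 hU
    obtain ⟨N, hN⟩ := T.exists_dist_lt ε hε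
    obtain ⟨v, hv⟩ := T.mem_limitSet.1 hx N
    obtain ⟨e, he⟩ := T.mem_limitSet.1 hx (N + 1)
    obtain ⟨g, hg, hne⟩ := T.exists_par_eq_ne v e
    obtain ⟨y, hy, hyL⟩ := T.cell_inter_limitSet_nonempty g
    refine ⟨y, ⟨hball ?_, hyL⟩, ?_⟩
    · exact hN N le_rfl v y (hg ▸ T.cell_subset g hy) x hv
    · rintro rfl
      exact hne (T.eq_of_mem_cell hy he)
  · intro t hsub ht x hx y hy
    refine eq_of_forall_dist_le fun ε hε => ?_
    obtain ⟨N, hN⟩ := T.exists_dist_lt ε hε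
    obtain ⟨v, hv⟩ := T.mem_limitSet.1 (hsub hx) N
    exact (hN N le_rfl v x hv y (T.isPreconnected_subset_cell ht hsub hx hy hv)).le

theorem exists_generation [CompactSpace X] {ε : ℝ} (hε : 0 < ε) :
    ∃ n, (∀ v : V n, ∀ x ∈ T.cell v, ∀ y ∈ T.cell v, dist x y < ε) ∧
      ∀ v : V n, ∀ x ∈ T.cell v, ∀ y ∈ T.cell v, dist (Φ x) (Φ y) < ε := by
  obtain ⟨δ, hδ, hΦ⟩ := Metric.uniformContinuous_iff.1
    (CompactSpace.uniformContinuous_of_continuous Φ.continuous) ε hε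
  obtain ⟨N, hN⟩ := T.exists_dist_lt (min δ ε) (lt_min hδ hε)
  exact ⟨N, fun v x hx y hy => (hN N le_rfl v x hx y hy).trans_le (min_le_right _ _),
    fun v x hx y hy => hΦ ((hN N le_rfl v x hx y hy).trans_le (min_le_left _ _))⟩

theorem map_mem_limitSet [CompactSpace X] {x : X} (hx : x ∈ T.limitSet) : Φ x ∈ T.limitSet := by
  rw [← T.isClosed_limitSet.closure_eq, Metric.mem_closure_iff]
  intro ε hε
  obtain ⟨n, h1, h2⟩ := T.exists_generation (half_pos hε)
  obtain ⟨v, hv⟩ := T.mem_limitSet.1 hx n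
  obtain ⟨w, hw⟩ := T.exists_rel v
  obtain ⟨_, ⟨y, hy, rfl⟩, hyw⟩ := T.image_inter_nonempty hw
  obtain ⟨z, hz, hzL⟩ := T.cell_inter_limitSet_nonempty w
  refine ⟨z, hzL, ?_⟩
  linarith [dist_triangle (Φ x) (Φ y) z, h2 v x hv y hy, h1 w _ hyw z hz]

theorem image_limitSet [CompactSpace X] : Φ '' T.limitSet = T.limitSet := by
  refine subset_antisymm (image_subset_iff.2 fun x hx => T.map_mem_limitSet hx) fun y hy => ?_
  have hcl : IsClosed (Φ '' T.limitSet) :=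
    (T.isClosed_limitSet.isCompact.image Φ.continuous).isClosed
  rw [← hcl.closure_eq, Metric.mem_closure_iff]
  intro ε hε
  obtain ⟨n, h1, h2⟩ := T.exists_generation (half_pos hε)
  obtain ⟨w, hw⟩ := T.mem_limitSet.1 hy n
  obtain ⟨v, hv⟩ := T.exists_rel_left w
  obtain ⟨_, ⟨p, hp, rfl⟩, hpw⟩ := T.image_inter_nonempty hv
  obtain ⟨q, hq, hqL⟩ := T.cell_inter_limitSet_nonempty v
  refine ⟨Φ q, mem_image_of_mem _ hqL, ?_⟩
  linarith [dist_triangle y (Φ p) (Φ q), h2 v p hp q hq, h1 w y hw _ hpw]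

theorem iterate_mem_limitSet [CompactSpace X] {x : X} (hx : x ∈ T.limitSet) (j : ℕ) :
    Φ^[j] x ∈ T.limitSet := by
  induction j with
  | zero => exact hx
  | succ j ih =>
    rw [Function.iterate_succ_apply']
    exact T.map_mem_limitSet ih

/-- The cell of generation `n` that contains the point `x` (arbitrary if there is none). -/
noncomputable def code (n : ℕ) (x : X) : V n :=
  if h : ∃ v : V n, x ∈ T.cell v then h.choose else (T.nonempty_generation n).some

theorem code_eq {n : ℕ} {x : X} {v : V n} (hv : x ∈ T.cell v) : T.code n x = v := by
  have h : ∃ v : V n, x ∈ T.cell v := ⟨v, hv⟩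
  rw [code, dif_pos h]
  exact T.eq_of_mem_cell h.choose_spec hv

theorem mem_cell_code {x : X} (hx : x ∈ T.limitSet) (n : ℕ) : x ∈ T.cell (T.code n x) := by
  obtain ⟨v, hv⟩ := T.mem_limitSet.1 hx n
  rwa [T.code_eq hv]

theorem mem_cell_iff {x : X} (hx : x ∈ T.limitSet) {n : ℕ} (v : V n) :
    x ∈ T.cell v ↔ T.code n x = v :=
  ⟨T.code_eq, fun h => h ▸ T.mem_cell_code hx n⟩

theorem par_code {x : X} (hx : x ∈ T.limitSet) (n : ℕ) : T.par (T.code (n + 1) x) = T.code n x :=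
  (T.code_eq (T.cell_subset _ (T.mem_cell_code hx (n + 1)))).symm

theorem rel_code [CompactSpace X] {x : X} (hx : x ∈ T.limitSet) (n : ℕ) :
    T.rel (T.code n x) (T.code n (Φ x)) := by
  by_contra h
  have := T.image_inter_eq_empty h
  exact Set.notMem_empty (Φ x) (this ▸ ⟨mem_image_of_mem _ (T.mem_cell_code hx n),
    T.mem_cell_code (T.map_mem_limitSet hx) n⟩)

theorem next_code [CompactSpace X] {x : X} (hx : x ∈ T.limitSet) (n : ℕ) :
    T.next (T.code (n + 1) x) = T.code n (Φ x) := by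
  rw [((T.rel_iff _ _).1 (T.rel_code hx (n + 1))).2, T.par_code (T.map_mem_limitSet hx)]

theorem prev_code [CompactSpace X] {x : X} (hx : x ∈ T.limitSet) (n : ℕ) :
    T.prev (T.code (n + 1) (Φ x)) = T.code n x := by
  rw [← ((T.rel_iff _ _).1 (T.rel_code hx (n + 1))).1, T.par_code hx]

end LimitSet

end AtomTower

namespace AtomTower

section UniformMeasure

open scoped Classical ENNReal

variable {X : Type*} [MetricSpace X] {Φ : C(X, X)} {V : ℕ → Type*} [∀ n, Fintype (V n)]
  (T : AtomTower Φ V) [MeasurableSpace X]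

/-- A measure that gives the same mass to all cells of a generation. -/
def IsUniform (ν : Measure X) : Prop :=
  ∀ {n : ℕ} (v : V n), ν.real (T.cell v) = (1 / 2 : ℝ) ^ (n ^ 2)

theorem exists_measure_le_cell (k : ℕ) : ∃ μ : ProbabilityMeasure X, ∀ n j, n + j = k →
    ∀ u : V n, (2⁻¹ : ℝ≥0∞) ^ (n ^ 2) ≤ (μ : Measure X) (T.cell u) := by
  choose p hp using fun v : V k => T.nonempty_cell v
  let μ : Measure X := (2⁻¹ : ℝ≥0∞) ^ (k ^ 2) • ∑ v : V k, Measure.dirac (p v)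
  have hpow : ∀ a : ℕ, (2⁻¹ : ℝ≥0∞) ^ a * 2 ^ a = 1 := fun a => by
    rw [← mul_pow, ENNReal.inv_mul_cancel (by norm_num) (by norm_num), one_pow]
  have hμ : IsProbabilityMeasure μ := by
    constructor
    simp only [μ, Measure.smul_apply, Measure.finsetSum_apply, measure_univ, Finset.sum_const,
      smul_eq_mul, Finset.card_univ, T.card_generation k, nsmul_eq_mul, mul_one]
    push_cast
    exact hpow _
  refine ⟨⟨μ, hμ⟩, ?_⟩
  rintro n j rfl u
  have hcard : ((Finset.univ.filter fun v : V (n + j) => T.anc j v = u).card : ℝ≥0∞) ≤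
      ∑ v : V (n + j), Measure.dirac (p v) (T.cell u) := by
    rw [Finset.card_filter]
    push_cast
    refine Finset.sum_le_sum fun v _ => ?_
    split_ifs with h
    · rw [Measure.dirac_apply_of_mem (h ▸ T.cell_subset_anc j v (hp v))]
    · exact zero_le
  have hc : ((Finset.univ.filter fun v : V (n + j) => T.anc j v = u).card : ℝ≥0∞) * 2 ^ (n ^ 2)
      = 2 ^ ((n + j) ^ 2) := mod_cast congrArg (Nat.cast (R := ℝ≥0∞)) (T.card_anc j u)
  calc (2⁻¹ : ℝ≥0∞) ^ (n ^ 2)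
      = (2⁻¹ : ℝ≥0∞) ^ ((n + j) ^ 2) *
          (Finset.univ.filter fun v : V (n + j) => T.anc j v = u).card := by
        rw [← one_mul ((2⁻¹ : ℝ≥0∞) ^ (n ^ 2)), ← hpow ((n + j) ^ 2), ← hc, mul_assoc, mul_assoc,
          mul_comm (2 ^ _) ((2⁻¹ : ℝ≥0∞) ^ (n ^ 2)), hpow, mul_one]
    _ ≤ _ := by
        simp only [ProbabilityMeasure.coe_mk, μ, Measure.smul_apply, Measure.finsetSum_apply,
          smul_eq_mul]
        gcongr

variable [BorelSpace X]

theorem exists_isUniform [CompactSpace X] :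
    ∃ ν : Measure X, IsProbabilityMeasure ν ∧ T.IsUniform ν := by
  choose μ hμ using T.exists_measure_le_cell
  let f : Ultrafilter ℕ := Ultrafilter.of atTop
  have hf : (f : Filter ℕ) ≤ atTop := Ultrafilter.of_le atTop
  obtain ⟨ν, hν⟩ : ∃ ν, Tendsto μ f (𝓝 ν) := ⟨(f.map μ).lim, (f.map μ).le_nhds_lim⟩
  have hle : ∀ {n : ℕ} (v : V n), (1 / 2 : ℝ) ^ (n ^ 2) ≤ (ν : Measure X).real (T.cell v) := by
    intro n v
    have h1 : (2⁻¹ : ℝ≥0∞) ^ (n ^ 2) ≤ (ν : Measure X) (T.cell v) := by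
      refine le_trans ?_ (ProbabilityMeasure.limsup_measure_closed_le_of_tendsto hν
        (T.isClosed_cell v))
      refine le_limsup_of_frequently_le (Eventually.frequently ?_)
      filter_upwards [hf (eventually_ge_atTop n)] with k hk
      exact hμ k n (k - n) (Nat.add_sub_cancel' hk) v
    have h2 := ENNReal.toReal_mono (measure_ne_top _ _) h1
    simpa [Measure.real] using h2
  refine ⟨ν, inferInstance, fun {n} v => ?_⟩
  have hsum : ∑ w : V n, (ν : Measure X).real (T.cell w) ≤ 1 := by
    rw [← measureReal_iUnion_fintype (fun _ _ h => T.disjoint_cell h)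
      fun w => (T.isClosed_cell w).measurableSet]
    exact measureReal_le_one
  have hconst : ∑ _w : V n, (1 / 2 : ℝ) ^ (n ^ 2) = 1 := by
    rw [Finset.sum_const, Finset.card_univ, T.card_generation n, nsmul_eq_mul]
    push_cast
    rw [← mul_pow]
    norm_num
  have hge : ∑ _w : V n, (1 / 2 : ℝ) ^ (n ^ 2) ≤ ∑ w : V n, (ν : Measure X).real (T.cell w) :=
    Finset.sum_le_sum fun w _ => hle w
  exact (((Finset.sum_eq_sum_iff_of_le fun w _ => hle w).1
    (le_antisymm hge (hsum.trans hconst.ge))) v (Finset.mem_univ v)).symm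

variable {T} {ν : Measure X} [IsProbabilityMeasure ν]

theorem IsUniform.measure_compl_limitSet (hν : T.IsUniform ν) : ν T.limitSetᶜ = 0 := by
  rw [limitSet, compl_iInter, measure_iUnion_null_iff]
  intro n
  have hm : MeasurableSet (⋃ v : V n, T.cell v) :=
    MeasurableSet.iUnion fun v => (T.isClosed_cell v).measurableSet
  rw [← measureReal_eq_zero_iff, probReal_compl_eq_one_sub hm,
    measureReal_iUnion_fintype (fun _ _ h => T.disjoint_cell h)
      fun w => (T.isClosed_cell w).measurableSet, Finset.sum_congr rfl fun v _ => hν v,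
    Finset.sum_const, Finset.card_univ, T.card_generation n, nsmul_eq_mul]
  push_cast
  rw [← mul_pow]
  norm_num

theorem IsUniform.ae_mem (hν : T.IsUniform ν) : ∀ᵐ x ∂ν, x ∈ T.limitSet := by
  rw [ae_iff]
  exact hν.measure_compl_limitSet

theorem measurableSet_code_eq {n : ℕ} (v : V n) : MeasurableSet {x | T.code n x = v} := by
  have hU : MeasurableSet (⋃ w : V n, T.cell w) :=
    MeasurableSet.iUnion fun w => (T.isClosed_cell w).measurableSet
  have : {x | T.code n x = v} = T.cell v ∪
      ((⋃ w : V n, T.cell w)ᶜ ∩ {_x | (T.nonempty_generation n).some = v}) := by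
    ext x
    by_cases h : ∃ w : V n, x ∈ T.cell w
    · obtain ⟨w, hw⟩ := h
      simp only [mem_ofPred_eq, T.code_eq hw, mem_union, mem_inter_iff, mem_compl_iff, mem_iUnion]
      constructor
      · rintro rfl
        exact Or.inl hw
      · rintro (h | h)
        · exact T.eq_of_mem_cell hw h
        · exact absurd ⟨w, hw⟩ h.1
    · have h' : x ∉ T.cell v := fun hx => h ⟨v, hx⟩
      simp [code, h', not_exists.1 h]
  rw [this]
  exact (T.isClosed_cell v).measurableSet.union (hU.compl.inter (MeasurableSet.const _))

theorem measurableSet_code_mem {n : ℕ} (F : Finset (V n)) : MeasurableSet {x | T.code n x ∈ F} := by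
  have : {x | T.code n x ∈ F} = ⋃ v ∈ F, {x | T.code n x = v} := by
    ext x
    simp
  rw [this]
  exact F.measurableSet_biUnion fun v _ => measurableSet_code_eq v

theorem IsUniform.measureReal_code_eq (hν : T.IsUniform ν) {n : ℕ} (v : V n) :
    ν.real {x | T.code n x = v} = (1 / 2 : ℝ) ^ (n ^ 2) := by
  rw [← hν v]
  refine measureReal_congr ?_
  filter_upwards [hν.ae_mem] with x hx
  exact propext (T.mem_cell_iff hx v).symm

theorem IsUniform.measureReal_code_mem (hν : T.IsUniform ν) {n : ℕ} (F : Finset (V n)) :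
    ν.real {x | T.code n x ∈ F} = F.card * (1 / 2 : ℝ) ^ (n ^ 2) := by
  rw [← nsmul_eq_mul, ← Finset.sum_const]
  exact (sum_measureReal_preimage_singleton (μ := ν) F (f := T.code n)
    (fun v _ => measurableSet_code_eq v)).symm.trans
      (Finset.sum_congr rfl fun v _ => hν.measureReal_code_eq v)

end UniformMeasure

end AtomTower

namespace AtomTower

section Markov

open scoped Classical

variable {X : Type*} [MetricSpace X] {Φ : C(X, X)} {V : ℕ → Type*} [∀ n, Fintype (V n)]
  {T : AtomTower Φ V} [MeasurableSpace X] [BorelSpace X] {ν : Measure X}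

variable (T) in
/-- The itinerary of length `l` of a point through the cells of generation `n`. -/
noncomputable def word (l n : ℕ) (x : X) : Fin l → V n := fun j => T.code n (Φ^[j] x)

theorem measurable_iterate (Φ : C(X, X)) (j : ℕ) : Measurable Φ^[j] :=
  (Φ.continuous.iterate j).measurable

theorem measurableSet_word_eq {l n : ℕ} (w : Fin l → V n) :
    MeasurableSet (T.word l n ⁻¹' {w}) := by
  have : T.word l n ⁻¹' {w} = ⋂ j : Fin l, Φ^[j] ⁻¹' {x | T.code n x = w j} := by
    ext x
    simp [word, funext_iff]
  rw [this]
  exact MeasurableSet.iInter fun j => measurable_iterate Φ j (measurableSet_code_eq (w j))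

theorem measureReal_code_mem_family [IsFiniteMeasure ν] (l : ℕ) {n : ℕ} (F : ℕ → Finset (V n))
    (c : ℝ) (hc : ∀ w : ℕ → V n, (∀ j ≤ l, w j ∈ F j) →
      ν.real {x | ∀ j ≤ l, T.code n (Φ^[j] x) = w j} = c) :
    ν.real {x | ∀ j ≤ l, T.code n (Φ^[j] x) ∈ F j} =
      (∏ j ∈ Finset.range (l + 1), ((F j).card : ℝ)) * c := by
  have hset : {x | ∀ j ≤ l, T.code n (Φ^[j] x) ∈ F j} =
      T.word (l + 1) n ⁻¹' (Fintype.piFinset fun j : Fin (l + 1) => F j) := by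
    ext x
    simp only [mem_ofPred_eq, mem_preimage, Finset.mem_coe, Fintype.mem_piFinset, word]
    exact ⟨fun h j => h j (Nat.lt_succ_iff.1 j.2), fun h j hj => h ⟨j, Nat.lt_succ_iff.2 hj⟩⟩
  have hterm : ∀ w ∈ Fintype.piFinset fun j : Fin (l + 1) => F j,
      ν.real (T.word (l + 1) n ⁻¹' {w}) = c := by
    intro w hw
    rw [Fintype.mem_piFinset] at hw
    let w' : ℕ → V n := fun j => if h : j < l + 1 then w ⟨j, h⟩ else w 0
    have hw' : ∀ j (h : j < l + 1), w' j = w ⟨j, h⟩ := fun j h => dif_pos h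
    rw [← hc w' fun j hj => by
      rw [hw' j (Nat.lt_succ_iff.2 hj)]; exact hw ⟨j, Nat.lt_succ_iff.2 hj⟩]
    congr 1
    ext x
    simp only [mem_ofPred_eq, mem_preimage, mem_singleton_iff, funext_iff, word]
    constructor
    · intro h j hj
      rw [hw' j (Nat.lt_succ_iff.2 hj)]
      exact h ⟨j, Nat.lt_succ_iff.2 hj⟩
    · intro h j
      rw [h j (Nat.lt_succ_iff.1 j.2), hw' j j.2]
  rw [hset, ← sum_measureReal_preimage_singleton _ fun w _ => measurableSet_word_eq w,
    Finset.sum_congr rfl hterm, Finset.sum_const, Fintype.card_piFinset, nsmul_eq_mul,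
    Finset.prod_range]
  push_cast
  rfl

variable [CompactSpace X] [IsProbabilityMeasure ν]

/-- The itineraries through the cells of generation `n` are distributed as the stationary Markov
chain that moves from a cell to each of its `2 ^ n` successors with the same probability. -/
theorem IsUniform.measureReal_path (hν : T.IsUniform ν) (l : ℕ) {n : ℕ} (w : ℕ → V n)
    (hw : ∀ j < l, T.rel (w j) (w (j + 1))) :
    ν.real {x | ∀ j ≤ l, T.code n (Φ^[j] x) = w j} = (1 / 2 : ℝ) ^ (n ^ 2 + n * l) := by
  induction l generalizing n with
  | zero => simpa using hν.measureReal_code_eq (w 0)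
  | succ l ih =>
    let F : ℕ → Finset (V (n + 1)) := fun j => Nat.casesOn j
      (Finset.univ.filter fun g => T.par g = w 0 ∧ T.next g = w 1)
      fun j => Finset.univ.filter fun g =>
        T.prev g = w j ∧ T.par g = w (j + 1) ∧ T.next g = w (j + 2)
    have hF0 : ∀ g, g ∈ F 0 ↔ T.par g = w 0 ∧ T.next g = w 1 := fun g => by simp [F]
    have hF1 : ∀ j g, g ∈ F (j + 1) ↔
        T.prev g = w j ∧ T.par g = w (j + 1) ∧ T.next g = w (j + 2) := fun j g => by simp [F]
    have hFpn : ∀ j g, g ∈ F j → T.par g = w j ∧ T.next g = w (j + 1) := by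
      rintro (_ | j) g hg
      · exact (hF0 g).1 hg
      · exact ((hF1 j g).1 hg).2
    have hset : ν.real {x | ∀ j ≤ l + 1, T.code n (Φ^[j] x) = w j} =
        ν.real {x | ∀ j ≤ l, T.code (n + 1) (Φ^[j] x) ∈ F j} := by
      refine measureReal_congr ?_
      filter_upwards [hν.ae_mem] with x hx
      have hit := T.iterate_mem_limitSet hx
      refine propext ⟨fun h j hj => ?_, fun h j hj => ?_⟩
      · have hp : T.par (T.code (n + 1) (Φ^[j] x)) = w j := by
          rw [T.par_code (hit j)]; exact h j (by omega)
        have hn : T.next (T.code (n + 1) (Φ^[j] x)) = w (j + 1) := by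
          rw [T.next_code (hit j), ← Function.iterate_succ_apply' Φ j x]
          exact h (j + 1) (by omega)
        rcases j with _ | j
        · exact (hF0 _).2 ⟨hp, hn⟩
        · refine (hF1 j _).2 ⟨?_, hp, hn⟩
          rw [Function.iterate_succ_apply', T.prev_code (hit j)]
          exact h j (by omega)
      · rcases j with _ | j
        · rw [← T.par_code (hit 0)]
          exact (hFpn 0 _ (h 0 (by omega))).1
        · rw [Function.iterate_succ_apply', ← T.next_code (hit j)]
          exact (hFpn j _ (h j (by omega))).2
    rw [hset, measureReal_code_mem_family l F ((1 / 2 : ℝ) ^ ((n + 1) ^ 2 + (n + 1) * l))]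
    · have hc0 : (F 0).card = 2 ^ (n + 1) := by
        rw [pow_succ, ← T.card_rel_left (w 0), ← T.card_par_next (hw 0 (by omega))]
        rfl
      have hc1 : ∀ j ∈ Finset.range l, ((F (j + 1)).card : ℝ) = 2 := fun j hj => by
        have hj := Finset.mem_range.1 hj
        exact_mod_cast T.card_fiber (hw j (by omega)) (hw (j + 1) (by omega))
      rw [Finset.prod_range_succ', Finset.prod_congr rfl hc1, Finset.prod_const, hc0,
        Finset.card_range]
      push_cast
      rw [← pow_add, show (n + 1) ^ 2 + (n + 1) * l = (n ^ 2 + n * (l + 1)) + (l + (n + 1)) by ring,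
        pow_add _ (n ^ 2 + n * (l + 1)), mul_left_comm, ← mul_pow]
      norm_num
    · intro u hu
      refine ih u fun j hj => (T.rel_iff _ _).2 ?_
      have h1 := hFpn j _ (hu j hj.le)
      have h2 := (hF1 j _).1 (hu (j + 1) hj)
      exact ⟨h1.1.trans h2.1.symm, h1.2.trans h2.2.1.symm⟩

theorem IsUniform.measureReal_path_between (hν : T.IsUniform ν) (k : ℕ) {n : ℕ}
    (g e : V (n + 1)) (w : ℕ → V n) (hw : ∀ j < k + 2, T.rel (w j) (w (j + 1)))
    (hw0 : w 0 = T.par g) (hw1 : w 1 = T.next g) (hwk : w (k + 1) = T.prev e)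
    (hwk' : w (k + 2) = T.par e) :
    ν.real {x | (T.code (n + 1) x = g ∧ T.code (n + 1) (Φ^[k + 2] x) = e) ∧
        ∀ j ≤ k, T.code n (Φ^[j + 1] x) = w (j + 1)} =
      (1 / 2 : ℝ) ^ (4 * n + 2) * ν.real {x | ∀ j ≤ k, T.code n (Φ^[j] x) = w (j + 1)} := by
  let F : ℕ → Finset (V (n + 1)) := fun j => Nat.casesOn j {g} fun j =>
    if j = k + 1 then {e} else Finset.univ.filter fun g =>
      T.prev g = w j ∧ T.par g = w (j + 1) ∧ T.next g = w (j + 2)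
  have hF0 : ∀ v, v ∈ F 0 ↔ v = g := fun v => by simp [F]
  have hFe : ∀ v, v ∈ F (k + 2) ↔ v = e := fun v => by simp [F]
  have hF1 : ∀ j ≤ k, ∀ v, v ∈ F (j + 1) ↔
      T.prev v = w j ∧ T.par v = w (j + 1) ∧ T.next v = w (j + 2) := fun j hj v => by
    simp [F, show j ≠ k + 1 by omega]
  have hset : ν.real {x | (T.code (n + 1) x = g ∧ T.code (n + 1) (Φ^[k + 2] x) = e) ∧
        ∀ j ≤ k, T.code n (Φ^[j + 1] x) = w (j + 1)} =
      ν.real {x | ∀ j ≤ k + 2, T.code (n + 1) (Φ^[j] x) ∈ F j} := by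
    refine measureReal_congr ?_
    filter_upwards [hν.ae_mem] with x hx
    have hit := T.iterate_mem_limitSet hx
    refine propext ⟨?_, fun h => ⟨⟨(hF0 _).1 (h 0 (by omega)), (hFe _).1 (h (k + 2) le_rfl)⟩,
      fun j hj => ?_⟩⟩
    · rintro ⟨⟨hg, he⟩, h⟩
      have hall : ∀ j ≤ k + 2, T.code n (Φ^[j] x) = w j := by
        rintro (_ | j) hj
        · rw [hw0, ← hg, T.par_code hx]; rfl
        · rcases (show j ≤ k ∨ j = k + 1 by omega) with hj' | rfl
          · exact h j hj'
          · rw [hwk', ← he, T.par_code (hit _)]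
      rintro (_ | j) hj
      · exact (hF0 _).2 hg
      · rcases (show j ≤ k ∨ j = k + 1 by omega) with hj' | rfl
        · refine (hF1 j hj' _).2 ⟨?_, ?_, ?_⟩
          · rw [Function.iterate_succ_apply', T.prev_code (hit j)]
            exact hall j (by omega)
          · rw [T.par_code (hit _)]
            exact h j hj'
          · rw [T.next_code (hit _), ← Function.iterate_succ_apply' Φ (j + 1) x]
            exact hall (j + 2) (by omega)
        · exact (hFe _).2 he
    · rw [← T.par_code (hit _)]
      exact ((hF1 j hj _).1 (h (j + 1) (by omega))).2.1
  rw [hset, measureReal_code_mem_family (k + 2) F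
    ((1 / 2 : ℝ) ^ ((n + 1) ^ 2 + (n + 1) * (k + 2))),
    hν.measureReal_path k (fun j => w (j + 1)) fun j hj => hw (j + 1) (by omega)]
  · have hc0 : (F 0).card = 1 := by simp [F]
    have hce : (F (k + 2)).card = 1 := by simp [F]
    have hc1 : ∀ j ∈ Finset.range (k + 1), ((F (j + 1)).card : ℝ) = 2 := fun j hj => by
      have hj := Finset.mem_range.1 hj
      have : F (j + 1) = Finset.univ.filter fun v =>
          T.prev v = w j ∧ T.par v = w (j + 1) ∧ T.next v = w (j + 2) := by
        ext v
        rw [hF1 j (by omega) v]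
        simp
      rw [this]
      exact_mod_cast T.card_fiber (hw j (by omega)) (hw (j + 1) (by omega))
    rw [Finset.prod_range_succ', Finset.prod_range_succ, Finset.prod_congr rfl hc1,
      Finset.prod_const, hc0, hce, Finset.card_range]
    rw [← pow_add, show (n + 1) ^ 2 + (n + 1) * (k + 2) =
      (4 * n + 2 + (n ^ 2 + n * k)) + (k + 1) by ring, pow_add _ _ (k + 1)]
    push_cast
    rw [mul_one, mul_one, mul_left_comm, ← mul_pow]
    norm_num
  · intro u hu
    refine hν.measureReal_path _ u fun j hj => (T.rel_iff _ _).2 ?_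
    have h2 := hu (j + 1) hj
    rcases j with _ | j
    · rw [(hF0 _).1 (hu 0 (by omega)), ← hw0, ← hw1]
      have := (hF1 0 (by omega) _).1 h2
      exact ⟨this.1.symm, this.2.1.symm⟩
    · have h1 := (hF1 j (by omega) _).1 (hu (j + 1) hj.le)
      rcases (show j < k ∨ j = k by omega) with hj' | rfl
      · have h2 := (hF1 (j + 1) (by omega) _).1 h2
        exact ⟨h1.2.1.trans h2.1.symm, h1.2.2.trans h2.2.1.symm⟩
      · rw [(hFe _).1 h2, ← hwk, ← hwk']
        exact h1.2

theorem sum_measureReal_inter_preimage {α ι : Type*} [MeasurableSpace α] [Fintype ι]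
    (μ : Measure α) [IsFiniteMeasure μ] {f : α → ι} (hf : ∀ i, MeasurableSet (f ⁻¹' {i}))
    (s : Set α) : ∑ i, μ.real (s ∩ f ⁻¹' {i}) = μ.real s := by
  have h := sum_measureReal_preimage_singleton (μ := μ.restrict s) Finset.univ
    (f := f) fun i _ => hf i
  simp only [Finset.coe_univ, preimage_univ, measureReal_restrict_apply (hf _),
    measureReal_restrict_apply MeasurableSet.univ, univ_inter] at h
  simpa only [inter_comm] using h

/-- After `2 * n` steps the cells of generation `n` are exactly independent. -/
theorem IsUniform.measureReal_code_pair (hν : T.IsUniform ν) {n : ℕ} (v u : V n) (l : ℕ)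
    (hl : 2 * n ≤ l) :
    ν.real {x | T.code n x = v ∧ T.code n (Φ^[l] x) = u} = (1 / 2 : ℝ) ^ (2 * n ^ 2) := by
  induction n generalizing l with
  | zero =>
    have : {x | T.code 0 x = v ∧ T.code 0 (Φ^[l] x) = u} = univ := by
      ext x
      simp only [T.eq_root v, T.eq_root u, mem_univ, iff_true]
      exact ⟨T.eq_root _, T.eq_root _⟩
    rw [this]
    simp
  | succ n ih =>
    obtain ⟨k, rfl⟩ : ∃ k, l = k + 2 := ⟨l - 2, by omega⟩
    have hterm : ∀ w : Fin (k + 1) → V n,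
        ν.real ({x | T.code (n + 1) x = v ∧ T.code (n + 1) (Φ^[k + 2] x) = u} ∩
          (fun x => T.word (k + 1) n (Φ x)) ⁻¹' {w}) = (1 / 2 : ℝ) ^ (4 * n + 2) *
        ν.real ({x | T.code n x = T.next v ∧ T.code n (Φ^[k] x) = T.prev u} ∩
          T.word (k + 1) n ⁻¹' {w}) := by
      intro w
      let w' : ℕ → V n := fun j => Nat.casesOn j (T.par v) fun j =>
        if h : j < k + 1 then w ⟨j, h⟩ else T.par u
      have hw0 : w' 0 = T.par v := rfl
      have hwj : ∀ j (h : j < k + 1), w' (j + 1) = w ⟨j, h⟩ := fun j h => dif_pos h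
      have hwk : w' (k + 2) = T.par u := dif_neg (by omega)
      have hword : ∀ x, T.word (k + 1) n x = w ↔ ∀ j ≤ k, T.code n (Φ^[j] x) = w' (j + 1) := by
        intro x
        rw [funext_iff]
        constructor
        · intro h j hj
          rw [hwj j (by omega)]
          exact h ⟨j, by omega⟩
        · intro h j
          rw [← hwj j j.2]
          exact h j (by omega)
      have hset1 : {x | T.code (n + 1) x = v ∧ T.code (n + 1) (Φ^[k + 2] x) = u} ∩
          (fun x => T.word (k + 1) n (Φ x)) ⁻¹' {w} =
          {x | (T.code (n + 1) x = v ∧ T.code (n + 1) (Φ^[k + 2] x) = u) ∧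
            ∀ j ≤ k, T.code n (Φ^[j + 1] x) = w' (j + 1)} := by
        ext x
        simp only [mem_inter_iff, mem_ofPred_eq, mem_preimage, mem_singleton_iff, hword,
          Function.iterate_succ_apply]
      have hset2 : {x | T.code n x = T.next v ∧ T.code n (Φ^[k] x) = T.prev u} ∩
          T.word (k + 1) n ⁻¹' {w} =
          {x | (T.code n x = T.next v ∧ T.code n (Φ^[k] x) = T.prev u) ∧
            ∀ j ≤ k, T.code n (Φ^[j] x) = w' (j + 1)} := by
        ext x
        simp only [mem_inter_iff, mem_ofPred_eq, mem_preimage, mem_singleton_iff, hword]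
      rw [hset1, hset2]
      rcases Classical.em ((∀ j < k + 2, T.rel (w' j) (w' (j + 1))) ∧ w' 1 = T.next v ∧
          w' (k + 1) = T.prev u) with hgood | hgood
      · obtain ⟨hg, hg1, hgk⟩ := hgood
        rw [hν.measureReal_path_between k v u w' hg hw0 hg1 hgk hwk]
        congr 2
        ext x
        refine ⟨fun h => ⟨⟨(h 0 (by omega)).trans hg1, (h k le_rfl).trans hgk⟩, h⟩, fun h => h.2⟩
      · have h1 : ν.real {x | (T.code (n + 1) x = v ∧ T.code (n + 1) (Φ^[k + 2] x) = u) ∧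
            ∀ j ≤ k, T.code n (Φ^[j + 1] x) = w' (j + 1)} = 0 := by
          rw [measureReal_eq_zero_iff]
          refine measure_mono_null (?_ : _ ⊆ T.limitSetᶜ) hν.measure_compl_limitSet
          intro x hx hxL
          obtain ⟨⟨hv, hu⟩, h⟩ := hx
          have hit := T.iterate_mem_limitSet hxL
          have hall : ∀ j ≤ k + 2, w' j = T.code n (Φ^[j] x) := by
            rintro (_ | j) hj
            · rw [hw0, ← hv, T.par_code hxL]; rfl
            · rcases (show j ≤ k ∨ j = k + 1 by omega) with hj' | rfl
              · exact (h j hj').symm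
              · rw [hwk, ← hu, T.par_code (hit _)]
          refine hgood ⟨fun j hj => ?_, ?_, ?_⟩
          · rw [hall j (by omega), hall (j + 1) (by omega), Function.iterate_succ_apply']
            exact T.rel_code (hit j) n
          · rw [hall 1 (by omega), ← hv, T.next_code hxL]; rfl
          · rw [hall (k + 1) (by omega), ← hu, Function.iterate_succ_apply' Φ (k + 1) x,
              T.prev_code (hit _)]
        have h2 : ν.real {x | (T.code n x = T.next v ∧ T.code n (Φ^[k] x) = T.prev u) ∧
            ∀ j ≤ k, T.code n (Φ^[j] x) = w' (j + 1)} = 0 := by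
          rw [measureReal_eq_zero_iff]
          refine measure_mono_null (?_ : _ ⊆ T.limitSetᶜ) hν.measure_compl_limitSet
          intro x hx hxL
          obtain ⟨⟨hv, hu⟩, h⟩ := hx
          have hit := T.iterate_mem_limitSet hxL
          have hw1 : w' 1 = T.next v := by rw [← hv]; exact (h 0 (by omega)).symm
          have hwk1 : w' (k + 1) = T.prev u := by rw [← hu]; exact (h k le_rfl).symm
          refine hgood ⟨?_, hw1, hwk1⟩
          rintro (_ | j) hj
          · rw [hw0, zero_add, hw1]
            exact T.rel_par_next v
          · rcases (show j < k ∨ j = k by omega) with hj' | rfl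
            · rw [← h j (by omega), ← h (j + 1) (by omega), Function.iterate_succ_apply']
              exact T.rel_code (hit j) n
            · rw [hwk1, hwk]
              exact T.rel_prev_par u
        rw [h1, h2, mul_zero]
    rw [← sum_measureReal_inter_preimage ν (f := fun x => T.word (k + 1) n (Φ x))
      (fun w => Φ.continuous.measurable (measurableSet_word_eq w)),
      Finset.sum_congr rfl fun w _ => hterm w, ← Finset.mul_sum,
      sum_measureReal_inter_preimage ν (fun w => measurableSet_word_eq w),
      ih _ _ k (by omega), ← pow_add]
    congr 1
    ring

end Markov

end AtomTower

namespace AtomTower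

section Mixing

open scoped Classical symmDiff

variable {X : Type*} [MetricSpace X] {Φ : C(X, X)} {V : ℕ → Type*} [∀ n, Fintype (V n)]
  {T : AtomTower Φ V}

variable (T) in
theorem card_next {n : ℕ} (c : V n) :
    (Finset.univ.filter fun g => T.next g = c).card = 2 ^ (2 * n + 1) := by
  rw [Finset.card_eq_sum_card_fiberwise (f := T.par)
    (t := Finset.univ.filter fun b => T.rel b c)]
  · have : ∀ b ∈ Finset.univ.filter (fun b => T.rel b c),
        ((Finset.univ.filter fun g => T.next g = c).filter fun g => T.par g = b).card
          = 2 ^ n * 2 := by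
      intro b hb
      rw [← T.card_rel_left b, ← T.card_par_next (by simpa using hb), Finset.filter_filter]
      simp only [and_comm]
    rw [Finset.sum_congr rfl this, Finset.sum_const, T.card_rel_left, smul_eq_mul]
    ring
  · intro g hg
    obtain rfl : T.next g = c := by simpa using hg
    simpa using T.rel_par_next g

variable (T) in
/-- The cells of generation `n` that meet the set `K`. -/
noncomputable def touching (n : ℕ) (K : Set X) : Finset (V n) :=
  Finset.univ.filter fun v => (T.cell v ∩ K).Nonempty

variable [MeasurableSpace X] [BorelSpace X] {ν : Measure X} [IsProbabilityMeasure ν]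

theorem IsUniform.tendsto_touching (hν : T.IsUniform ν) {K : Set X} (hK : IsClosed K) :
    Tendsto (fun n => ν.real {x | T.code n x ∈ T.touching n K}) atTop (𝓝 (ν.real K)) := by
  let U : ℕ → Set X := fun n => ⋃ v ∈ T.touching n K, T.cell v
  have hmem : ∀ n x, x ∈ U n ↔ ∃ v : V n, (T.cell v ∩ K).Nonempty ∧ x ∈ T.cell v := by
    intro n x
    simp [U, touching]
  have hU : ∀ n, MeasurableSet (U n) := fun n =>
    Finset.measurableSet_biUnion _ fun v _ => (T.isClosed_cell v).measurableSet
  have hanti : Antitone U := by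
    refine antitone_nat_of_succ_le fun n x hx => ?_
    obtain ⟨v, hvK, hxv⟩ := (hmem _ _).1 hx
    exact (hmem _ _).2 ⟨T.par v, hvK.mono (inter_subset_inter_left _ (T.cell_subset v)),
      T.cell_subset v hxv⟩
  have hcongr : ∀ n, ν.real {x | T.code n x ∈ T.touching n K} = ν.real (U n) := by
    intro n
    refine measureReal_congr ?_
    filter_upwards [hν.ae_mem] with x hx
    refine propext ⟨fun h => ?_, fun h => ?_⟩
    · exact mem_biUnion (show T.code n x ∈ (T.touching n K : Set (V n)) from h)
        (T.mem_cell_code hx n)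
    · obtain ⟨v, hvK, hxv⟩ := (hmem _ _).1 h
      change T.code n x ∈ T.touching n K
      rw [T.code_eq hxv]
      simpa [touching] using hvK
  have hinter : ν (⋂ n, U n) = ν K := by
    refine measure_congr ?_
    filter_upwards [hν.ae_mem] with x hx
    refine propext ⟨fun h => ?_, fun h => ?_⟩
    · change x ∈ K
      rw [← hK.closure_eq, Metric.mem_closure_iff]
      intro ε hε
      obtain ⟨N, hN⟩ := T.exists_dist_lt ε hε
      obtain ⟨v, ⟨y, hyv, hyK⟩, hxv⟩ := (hmem _ _).1 (mem_iInter.1 h N)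
      exact ⟨y, hyK, hN N le_rfl v x hxv y hyv⟩
    · exact mem_iInter.2 fun n => (hmem _ _).2
        ⟨_, ⟨x, T.mem_cell_code hx n, h⟩, T.mem_cell_code hx n⟩
  simp only [hcongr]
  have h := tendsto_measure_iInter_atTop (μ := ν) (fun n => (hU n).nullMeasurableSet) hanti
    ⟨0, measure_ne_top _ _⟩
  rw [hinter] at h
  exact (ENNReal.tendsto_toReal (measure_ne_top _ _)).comp h

theorem IsUniform.eq (hν : T.IsUniform ν) {μ : Measure X} [IsProbabilityMeasure μ]
    (hμ : T.IsUniform μ) : μ = ν := by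
  refine ext_of_generate_finite {s | IsClosed s} ?_ isPiSystem_isClosed (fun K hK => ?_) (by simp)
  · rw [BorelSpace.measurable_eq (α := X), borel_eq_generateFrom_isClosed]
  · have h1 := hμ.tendsto_touching hK
    simp only [hμ.measureReal_code_mem, ← hν.measureReal_code_mem] at h1
    have h2 := tendsto_nhds_unique h1 (hν.tendsto_touching hK)
    rwa [measureReal_def, measureReal_def,
      ENNReal.toReal_eq_toReal_iff' (measure_ne_top _ _) (measure_ne_top _ _)] at h2

theorem IsUniform.measurePreserving [CompactSpace X] (hν : T.IsUniform ν) :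
    MeasurePreserving Φ ν ν := by
  have hm : Measurable Φ := Φ.continuous.measurable
  refine ⟨hm, ?_⟩
  have : IsProbabilityMeasure (ν.map Φ) := Measure.isProbabilityMeasure_map hm.aemeasurable
  refine hν.eq fun {n} v => ?_
  rw [map_measureReal_apply hm (T.isClosed_cell v).measurableSet]
  have : ν.real (Φ ⁻¹' T.cell v) =
      ν.real {x | T.code (n + 1) x ∈ Finset.univ.filter fun g => T.next g = v} := by
    refine measureReal_congr ?_
    filter_upwards [hν.ae_mem] with x hx
    refine propext ?_
    change Φ x ∈ T.cell v ↔ T.code (n + 1) x ∈ Finset.univ.filter fun g => T.next g = v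
    rw [T.mem_cell_iff (T.map_mem_limitSet hx)]
    simp [T.next_code hx]
  rw [this, hν.measureReal_code_mem, T.card_next,
    show (n + 1) ^ 2 = (2 * n + 1) + n ^ 2 by ring, pow_add _ (2 * n + 1), ← mul_assoc]
  push_cast
  rw [← mul_pow]
  norm_num

/-- Every measurable set is approximated by unions of cells of all large generations. -/
theorem IsUniform.exists_approx (hν : T.IsUniform ν) {C : Set X} (hC : MeasurableSet C) {ε : ℝ}
    (hε : 0 < ε) : ∃ N, ∀ n ≥ N, ∃ F : Finset (V n), ν.real (C ∆ {x | T.code n x ∈ F}) < ε := by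
  obtain ⟨K, hKC, hK, hlt⟩ := hC.exists_isClosed_sdiff_lt (measure_ne_top ν C)
    (ENNReal.ofReal_pos.2 (half_pos hε)).ne'
  have hlt' : ν.real (C \ K) < ε / 2 := by
    rw [measureReal_def]
    exact (ENNReal.lt_ofReal_iff_toReal_lt (measure_ne_top _ _)).1 hlt
  obtain ⟨N, hN⟩ := eventually_atTop.1
    ((hν.tendsto_touching hK).eventually_lt_const (show ν.real K < ν.real K + ε / 2 by linarith))
  refine ⟨N, fun n hn => ⟨T.touching n K, ?_⟩⟩
  have hE := hN n hn
  set E : Set X := {x | T.code n x ∈ T.touching n K} with hEdef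
  have hsub : K ∩ T.limitSet ⊆ E := fun x hx => by
    simp only [hEdef, mem_ofPred_eq, touching, Finset.mem_filter, Finset.mem_univ, true_and]
    exact ⟨x, T.mem_cell_code hx.2 n, hx.1⟩
  have hKL : ν.real (K ∩ T.limitSet) = ν.real K := by
    refine measureReal_congr ?_
    filter_upwards [hν.ae_mem] with x hx
    exact propext ⟨fun h => h.1, fun h => ⟨h, hx⟩⟩
  have hd := measureReal_sdiff (μ := ν) hsub (hK.inter T.isClosed_limitSet).measurableSet
  rw [hKL] at hd
  have hnull : ν.real (T.limitSetᶜ) = 0 := by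
    rw [measureReal_eq_zero_iff]
    exact hν.measure_compl_limitSet
  have hcov : C ∆ E ⊆ (C \ K ∪ E \ (K ∩ T.limitSet)) ∪ T.limitSetᶜ := by
    rintro x (⟨h1, h2⟩ | ⟨h1, h2⟩)
    · by_cases hxK : x ∈ K
      · exact Or.inr fun hxL => h2 (hsub ⟨hxK, hxL⟩)
      · exact Or.inl (Or.inl ⟨h1, hxK⟩)
    · exact Or.inl (Or.inr ⟨h1, fun h => h2 (hKC h.1)⟩)
  have h1 := measureReal_mono (μ := ν) hcov
  have h2 := measureReal_union_le (μ := ν) (C \ K ∪ E \ (K ∩ T.limitSet)) T.limitSetᶜ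
  have h3 := measureReal_union_le (μ := ν) (C \ K) (E \ (K ∩ T.limitSet))
  linarith

theorem IsUniform.measureReal_code_mem_pair [CompactSpace X] (hν : T.IsUniform ν) {n : ℕ}
    (F G : Finset (V n)) {l : ℕ} (hl : 2 * n ≤ l) :
    ν.real (Φ^[l] ⁻¹' {x | T.code n x ∈ G} ∩ {x | T.code n x ∈ F}) =
      ν.real {x | T.code n x ∈ G} * ν.real {x | T.code n x ∈ F} := by
  have hfib : ∀ p : V n × V n, (fun x => (T.code n x, T.code n (Φ^[l] x))) ⁻¹' {p} =
      {x | T.code n x = p.1 ∧ T.code n (Φ^[l] x) = p.2} := by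
    intro p
    ext x
    simp [Prod.ext_iff]
  have hset : Φ^[l] ⁻¹' {x | T.code n x ∈ G} ∩ {x | T.code n x ∈ F} =
      (fun x => (T.code n x, T.code n (Φ^[l] x))) ⁻¹' (F ×ˢ G : Finset (V n × V n)) := by
    ext x
    simp [and_comm]
  rw [hset, ← sum_measureReal_preimage_singleton, Finset.sum_congr rfl fun p _ => by
    rw [hfib p, hν.measureReal_code_pair p.1 p.2 l hl], Finset.sum_const, Finset.card_product,
    hν.measureReal_code_mem, hν.measureReal_code_mem, nsmul_eq_mul]
  · push_cast
    ring
  · intro p _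
    rw [hfib p]
    exact (measurableSet_code_eq p.1).inter (measurable_iterate Φ l (measurableSet_code_eq p.2))

theorem abs_measureReal_sub_le_symmDiff {α : Type*} [MeasurableSpace α] {ν : Measure α}
    [IsFiniteMeasure ν] {A B : Set α} (hA : MeasurableSet A) (hB : MeasurableSet B) :
    |ν.real A - ν.real B| ≤ ν.real (A ∆ B) := by
  have h1 := measureReal_sdiff_add_inter (μ := ν) (s := A) hB
  have h2 := measureReal_sdiff_add_inter (μ := ν) (s := B) hA
  rw [inter_comm] at h2
  rw [measureReal_symmDiff_eq hA hB, abs_le]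
  constructor <;> linarith [measureReal_nonneg (μ := ν) (s := A \ B),
    measureReal_nonneg (μ := ν) (s := B \ A)]

theorem IsUniform.isMixing [CompactSpace X] (hν : T.IsUniform ν) : IsMixing Φ ν := by
  intro C D hC hD
  suffices h : Tendsto (fun l : ℕ => ν.real (Φ^[l] ⁻¹' D ∩ C)) atTop
      (𝓝 (ν.real D * ν.real C)) by
    rw [← ENNReal.tendsto_toReal_iff (fun _ => measure_ne_top _ _)
      (ENNReal.mul_ne_top (measure_ne_top _ _) (measure_ne_top _ _)), ENNReal.toReal_mul]
    exact h
  rw [Metric.tendsto_atTop]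
  intro ε hε
  have hε4 : 0 < ε / 4 := by linarith
  obtain ⟨N₁, h₁⟩ := hν.exists_approx hC hε4
  obtain ⟨N₂, h₂⟩ := hν.exists_approx hD hε4
  obtain ⟨n, hn₁, hn₂⟩ : ∃ n, N₁ ≤ n ∧ N₂ ≤ n := ⟨_, le_max_left _ _, le_max_right _ _⟩
  obtain ⟨F, hF⟩ := h₁ n hn₁
  obtain ⟨G, hG⟩ := h₂ n hn₂
  refine ⟨2 * n, fun l hl => ?_⟩
  have hpair := hν.measureReal_code_mem_pair F G hl
  have hmF := measurableSet_code_mem (T := T) F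
  have hmG := measurableSet_code_mem (T := T) G
  set C' : Set X := {x | T.code n x ∈ F}
  set D' : Set X := {x | T.code n x ∈ G}
  have hit := hν.measurePreserving.iterate l
  have hpre : ν.real (Φ^[l] ⁻¹' (D ∆ D')) = ν.real (D ∆ D') :=
    hit.measureReal_preimage (hD.symmDiff hmG).nullMeasurableSet
  have hsub : (Φ^[l] ⁻¹' D ∩ C) ∆ (Φ^[l] ⁻¹' D' ∩ C') ⊆ Φ^[l] ⁻¹' (D ∆ D') ∪ C ∆ C' := by
    intro x
    simp only [mem_symmDiff, mem_inter_iff, mem_preimage, mem_union]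
    tauto
  have e1 := abs_measureReal_sub_le_symmDiff (ν := ν) ((hit.measurable hD).inter hC)
    ((hit.measurable hmG).inter hmF)
  have e2 := measureReal_mono (μ := ν) hsub
  have e3 := measureReal_union_le (μ := ν) (Φ^[l] ⁻¹' (D ∆ D')) (C ∆ C')
  have e4 := abs_measureReal_sub_le_symmDiff (ν := ν) hC hmF
  have e5 := abs_measureReal_sub_le_symmDiff (ν := ν) hD hmG
  have e6 : |ν.real D' * ν.real C' - ν.real D * ν.real C| ≤ ε / 4 + ε / 4 := by
    have : ν.real D' * ν.real C' - ν.real D * ν.real C =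
        (ν.real D' - ν.real D) * ν.real C' + ν.real D * (ν.real C' - ν.real C) := by ring
    rw [this]
    refine (abs_add_le _ _).trans (add_le_add ?_ ?_)
    · rw [abs_mul, abs_of_nonneg (measureReal_nonneg (μ := ν) (s := C')), abs_sub_comm]
      nlinarith [measureReal_le_one (μ := ν) (s := C'), abs_nonneg (ν.real D - ν.real D')]
    · rw [abs_mul, abs_of_nonneg (measureReal_nonneg (μ := ν) (s := D)), abs_sub_comm]
      nlinarith [measureReal_le_one (μ := ν) (s := D), abs_nonneg (ν.real C - ν.real C')]
  rw [hpair] at e1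
  rw [Real.dist_eq]
  have e7 := abs_sub_le (ν.real (Φ^[l] ⁻¹' D ∩ C)) (ν.real D' * ν.real C')
    (ν.real D * ν.real C)
  linarith

end Mixing

end AtomTower

theorem IsMixing.ergodic {X : Type*} [MeasurableSpace X] {f : X → X} {ν : Measure X}
    [IsProbabilityMeasure ν] (hf : MeasurePreserving f ν ν) (hmix : IsMixing f ν) :
    Ergodic f ν := by
  refine ⟨hf, ⟨fun s hs hinv => ?_⟩⟩
  have hit : ∀ l : ℕ, f^[l] ⁻¹' s = s := by
    intro l
    induction l with
    | zero => rfl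
    | succ l ih => rw [Function.iterate_succ, preimage_comp, ih, hinv]
  have h := hmix s s hs hs
  simp only [hit, inter_self] at h
  have h2 : ν s = ν s * ν s := tendsto_nhds_unique tendsto_const_nhds h
  rw [eventuallyConst_set']
  by_cases h0 : ν s = 0
  · exact Or.inl (ae_eq_empty.2 h0)
  · refine Or.inr ?_
    have h1 : ν s = 1 := by
      have := (ENNReal.mul_right_inj h0 (measure_ne_top ν s) (b := ν s) (c := 1)).1
        (by rw [mul_one]; exact h2.symm)
      exact this
    rw [ae_eq_univ, prob_compl_eq_zero_iff hs]
    exact h1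

section Reindex

variable {X ι κ : Type*} [MeasurableSpace X] [Fintype ι] [Fintype κ]

theorem joinEntropy_comp_equiv (T : X → X) (ν : Measure X) (P : ι → Set X) (e : κ ≃ ι) (l : ℕ) :
    joinEntropy T ν (P ∘ e) l = joinEntropy T ν P l :=
  (Equiv.arrowCongr (Equiv.refl (Fin l)) e).sum_comp fun w : Fin l → ι =>
    Real.negMulLog (ν.real (⋂ j : Fin l, T^[(j : ℕ)] ⁻¹' P (w j)))

theorem partitionEntropy_comp_equiv (T : X → X) (ν : Measure X) (P : ι → Set X) (e : κ ≃ ι) :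
    partitionEntropy T ν (P ∘ e) = partitionEntropy T ν P := by
  simp only [partitionEntropy, joinEntropy_comp_equiv]

theorem IsFinitePartition.comp_equiv {X ι κ : Type*} [MeasurableSpace X] [Finite κ]
    {ν : Measure X} {P : ι → Set X} (hP : IsFinitePartition ν P)
    (e : κ ≃ ι) : IsFinitePartition ν (P ∘ e) where
  finite := inferInstance
  measurableSet i := hP.measurableSet (e i)
  disjoint i j h := hP.disjoint _ _ (e.injective.ne h)
  cover := by
    have : ⋃ i, (P ∘ e) i = ⋃ i, P i := e.surjective.iUnion_comp P
    rw [this, hP.cover]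

theorem partitionEntropy_le_metricEntropy (T : X → X) {ν : Measure X} {P : ι → Set X}
    (hP : IsFinitePartition ν P) : partitionEntropy T ν P ≤ metricEntropy T ν := by
  let e := (Fintype.equivFin ι).symm
  rw [← partitionEntropy_comp_equiv T ν P e]
  exact le_iSup_of_le _ (le_iSup_of_le _ (le_iSup_of_le (hP.comp_equiv e) le_rfl))

theorem partitionEntropy_eq_of_tendsto {T : X → X} {ν : Measure X} {P : ι → Set X} {h : ℝ}
    (hlim : Tendsto (fun l : ℕ => joinEntropy T ν P l / (l : ℝ)) atTop (𝓝 h)) :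
    partitionEntropy T ν P = (h : EReal) :=
  ((continuous_coe_real_ereal.tendsto h).comp hlim).limsup_eq

end Reindex

namespace AtomTower

section Entropy

open scoped Classical

variable {X : Type*} [MetricSpace X] {Φ : C(X, X)} {V : ℕ → Type*} [∀ n, Fintype (V n)]
  {T : AtomTower Φ V} [MeasurableSpace X] [BorelSpace X] {ν : Measure X} [IsProbabilityMeasure ν]

variable (T) in
/-- The traces of the cells of generation `n` on the limit set. -/
def trace (n : ℕ) (v : V n) : Set X := T.cell v ∩ T.limitSet

theorem IsUniform.isFinitePartition_trace (hν : T.IsUniform ν) (n : ℕ) :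
    IsFinitePartition ν (T.trace n) where
  finite := inferInstance
  measurableSet v := ((T.isClosed_cell v).inter T.isClosed_limitSet).measurableSet
  disjoint v w h := (T.disjoint_cell h).mono inter_subset_left inter_subset_left
  cover := by
    refine measure_mono_null (compl_subset_compl.2 fun x hx => ?_) hν.measure_compl_limitSet
    exact mem_iUnion.2 ⟨_, T.mem_cell_code hx n, hx⟩

variable [CompactSpace X]

theorem IsUniform.measureReal_iInter_trace (hν : T.IsUniform ν) {n l : ℕ} (w : Fin l → V n) :
    ν.real (⋂ j : Fin l, Φ^[(j : ℕ)] ⁻¹' T.trace n (w j)) = ν.real (T.word l n ⁻¹' {w}) := by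
  refine measureReal_congr ?_
  filter_upwards [hν.ae_mem] with x hx
  have hit := T.iterate_mem_limitSet hx
  refine propext ⟨fun h => ?_, fun h => ?_⟩
  · exact funext fun j => T.code_eq (mem_iInter.1 h j).1
  · exact mem_iInter.2 fun j => ⟨(T.mem_cell_iff (hit j) _).2 (congrFun h j), hit j⟩

theorem IsUniform.measureReal_word_eq (hν : T.IsUniform ν) {n l : ℕ} (w : Fin (l + 1) → V n) :
    ν.real (T.word (l + 1) n ⁻¹' {w}) = 0 ∨
      ν.real (T.word (l + 1) n ⁻¹' {w}) = (1 / 2 : ℝ) ^ (n ^ 2 + n * l) := by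
  let w' : ℕ → V n := fun j => if h : j < l + 1 then w ⟨j, h⟩ else w 0
  have hw' : ∀ j (h : j < l + 1), w' j = w ⟨j, h⟩ := fun j h => dif_pos h
  have hset : T.word (l + 1) n ⁻¹' {w} = {x | ∀ j ≤ l, T.code n (Φ^[j] x) = w' j} := by
    ext x
    simp only [mem_ofPred_eq, mem_preimage, mem_singleton_iff, funext_iff, word]
    constructor
    · intro h j hj
      rw [hw' j (Nat.lt_succ_iff.2 hj)]
      exact h ⟨j, Nat.lt_succ_iff.2 hj⟩
    · intro h j
      rw [h j (Nat.lt_succ_iff.1 j.2), hw' j j.2]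
  rw [hset]
  rcases Classical.em (∀ j < l, T.rel (w' j) (w' (j + 1))) with h | h
  · exact Or.inr (hν.measureReal_path l w' h)
  · refine Or.inl ?_
    rw [measureReal_eq_zero_iff]
    refine measure_mono_null (?_ : _ ⊆ T.limitSetᶜ) hν.measure_compl_limitSet
    intro x hx hxL
    refine h fun j hj => ?_
    rw [← hx j hj.le, ← hx (j + 1) hj, Function.iterate_succ_apply']
    exact T.rel_code (T.iterate_mem_limitSet hxL j) n

theorem IsUniform.joinEntropy_trace (hν : T.IsUniform ν) (n l : ℕ) :
    joinEntropy Φ ν (T.trace n) (l + 1) = ((n : ℝ) ^ 2 + n * l) * Real.log 2 := by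
  have hterm : ∀ w : Fin (l + 1) → V n,
      Real.negMulLog (ν.real (⋂ j : Fin (l + 1), Φ^[(j : ℕ)] ⁻¹' T.trace n (w j))) =
        ν.real (T.word (l + 1) n ⁻¹' {w}) * (((n : ℝ) ^ 2 + n * l) * Real.log 2) := by
    intro w
    rw [hν.measureReal_iInter_trace]
    rcases hν.measureReal_word_eq w with h | h
    · rw [h]; simp
    · rw [h, Real.negMulLog, Real.log_pow, one_div, Real.log_inv]
      push_cast
      ring
  rw [joinEntropy, Finset.sum_congr rfl fun w _ => hterm w, ← Finset.sum_mul,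
    sum_measureReal_preimage_singleton _ fun w _ => measurableSet_word_eq w]
  simp

theorem IsUniform.tendsto_joinEntropy_trace (hν : T.IsUniform ν) (n : ℕ) :
    Tendsto (fun l : ℕ => joinEntropy Φ ν (T.trace n) l / (l : ℝ)) atTop
      (𝓝 ((n : ℝ) * Real.log 2)) := by
  rw [← tendsto_add_atTop_iff_nat 1]
  have h0 : Tendsto (fun l : ℕ => (1 : ℝ) / ((l : ℝ) + 1)) atTop (𝓝 0) :=
    tendsto_one_div_add_atTop_nhds_zero_nat
  have h := (h0.const_mul (((n : ℝ) ^ 2 - n) * Real.log 2)).const_add ((n : ℝ) * Real.log 2)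
  rw [mul_zero, add_zero] at h
  refine h.congr fun l => ?_
  rw [hν.joinEntropy_trace]
  have : (l : ℝ) + 1 ≠ 0 := by positivity
  push_cast
  field_simp
  ring

theorem IsUniform.metricEntropy_eq_top (hν : T.IsUniform ν) : metricEntropy Φ ν = ⊤ := by
  refine EReal.eq_top_iff_forall_lt _ |>.2 fun y => ?_
  have hlog : 0 < Real.log 2 := Real.log_pos one_lt_two
  obtain ⟨n, hn⟩ := exists_nat_gt (y / Real.log 2)
  rw [div_lt_iff₀ hlog] at hn
  calc (y : EReal) < ((n * Real.log 2 : ℝ) : EReal) := EReal.coe_lt_coe_iff.2 hn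
    _ = partitionEntropy Φ ν (T.trace n) :=
      (partitionEntropy_eq_of_tendsto (hν.tendsto_joinEntropy_trace n)).symm
    _ ≤ metricEntropy Φ ν := partitionEntropy_le_metricEntropy _ (hν.isFinitePartition_trace n)

end Entropy

end AtomTower

theorem isCompact_unitCube (m : ℕ) : IsCompact (unitCube m) := by
  have h : unitCube m = (EuclideanSpace.equiv (Fin m) ℝ).toHomeomorph ⁻¹'
      (Set.univ.pi fun _ => Set.Icc (0 : ℝ) 1) := by
    ext x
    simp only [unitCube, mem_ofPred_eq, mem_preimage, mem_univ_pi]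
    rfl
  rw [h, Homeomorph.isCompact_preimage]
  exact isCompact_univ_pi fun _ => isCompact_Icc

instance compactSpace_cube (m : ℕ) : CompactSpace (Cube m) :=
  isCompact_iff_compactSpace.1 (isCompact_unitCube m)

instance nonempty_cube (m : ℕ) : Nonempty (Cube m) :=
  ⟨⟨0, fun i => by simp⟩⟩

theorem IsBox.nonempty {m : ℕ} {K : Set (Cube m)} (hK : IsBox K) : K.Nonempty := by
  obtain ⟨e⟩ := hK.2
  exact ⟨_, (e.symm (Classical.arbitrary _)).2⟩

namespace IsModelWith

variable {m : ℕ} {Φ : C(Cube m, Cube m)} {𝒜 : ℕ → Finset (Set (Cube m))}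

theorem eq_of_mem (hΦ : IsModelWith Φ 𝒜) {n : ℕ} {A B : Set (Cube m)} (hA : A ∈ 𝒜 n)
    (hB : B ∈ 𝒜 n) {x : Cube m} (hxA : x ∈ A) (hxB : x ∈ B) : A = B := by
  by_contra h
  exact Set.disjoint_left.1 (hΦ.disjoint n A hA B hB h) hxA hxB

/-- The first generation satisfies the conditions that are imposed on the later ones. -/
theorem isNextGeneration (hΦ : IsModelWith Φ 𝒜) (n : ℕ) :
    IsNextGeneration Φ n (𝒜 n) (𝒜 (n + 1)) := by
  rcases Nat.eq_zero_or_pos n with rfl | hn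
  · obtain ⟨A, hA, hAA⟩ := hΦ.gen_zero
    have hchild : childrenIn (𝒜 1) A = ↑(𝒜 1) := by
      ext G
      exact ⟨fun h => h.1, fun h => ⟨h, hΦ.gen_one_subset A (by simp [hA]) G h⟩⟩
    have hcard : (𝒜 1 : Set (Set (Cube m))).ncard = 2 := by
      rw [Set.ncard_coe_finset, hΦ.gen_one_card]
    have hsing : {D | D ∈ 𝒜 0 ∧ Arrow Φ D A} = {A} := by
      ext D
      simp only [hA, Finset.mem_singleton, mem_ofPred_eq, mem_singleton_iff]
      exact ⟨fun h => h.1, fun h => ⟨h, h ▸ hAA⟩⟩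
    have hsing' : {C | C ∈ 𝒜 0 ∧ Arrow Φ A C} = {A} := by
      ext D
      simp only [hA, Finset.mem_singleton, mem_ofPred_eq, mem_singleton_iff]
      exact ⟨fun h => h.1, fun h => ⟨h, h ▸ hAA⟩⟩
    have hmem : ∀ B ∈ 𝒜 0, B = A := fun B hB => by simpa [hA] using hB
    refine ⟨fun G hG => ⟨A, by simp [hA], hΦ.gen_one_subset A (by simp [hA]) G hG⟩, ?_,
      fun _ _ => ↑(𝒜 1), fun _ _ _ => ↑(𝒜 1), ?_, ?_, ?_, ?_, ?_, ?_, ?_⟩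
    · intro B hB
      rw [hmem B hB, zero_add, hchild, hcard]
      norm_num
    · intro B hB
      rw [hmem B hB, hsing, biUnion_singleton, hchild]
    · intro B hB
      rw [hmem B hB, hsing]
      exact pairwiseDisjoint_singleton _ _
    · intro D _ B _ _
      rw [hcard]
      norm_num
    · intro D _ B hB _
      rw [hmem B hB, hsing', biUnion_singleton]
    · intro D _ B hB _
      rw [hmem B hB, hsing']
      exact pairwiseDisjoint_singleton _ _
    · intro D _ B _ C _ _ _
      exact hcard
    · intro D _ B _ C _ _ _ G hG
      exact ⟨fun E hE => hΦ.gen_one_arrow G hG E hE, fun E hE hE' => absurd hE hE'⟩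
  · exact hΦ.gen_succ n hn

/-- Every atom of generation `n + 1` is labelled by the path `D → B → C` of atoms of
generation `n` for which it belongs to `Γ D B C`. -/
theorem exists_labels (hΦ : IsModelWith Φ 𝒜) (n : ℕ) :
    ∃ prev par next : {A // A ∈ 𝒜 (n + 1)} → {A // A ∈ 𝒜 n},
      (∀ g, g.1 ⊆ (par g).1) ∧ (∀ g, Arrow Φ (prev g).1 (par g).1) ∧
      (∀ g, Arrow Φ (par g).1 (next g).1) ∧
      (∀ d b c : {A // A ∈ 𝒜 n}, Arrow Φ d.1 b.1 → Arrow Φ b.1 c.1 →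
        {g | prev g = d ∧ par g = b ∧ next g = c}.ncard = 2) ∧
      (∀ g e, Arrow Φ g.1 e.1 ↔ par g = prev e ∧ next g = par e) ∧
      (∀ g e : {A // A ∈ 𝒜 (n + 1)}, ¬ Arrow Φ g.1 e.1 → Φ '' g.1 ∩ e.1 = ∅) := by
  have hgen := hΦ.isNextGeneration n
  obtain ⟨Ω, Γ, hΩ, hΩd, -, hΓ, hΓd, hΓc, hd⟩ := hgen.exists_subcollections
  have hΩsub : ∀ D ∈ 𝒜 n, ∀ B ∈ 𝒜 n, Arrow Φ D B → ∀ G ∈ Ω D B,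
      G ∈ 𝒜 (n + 1) ∧ G ⊆ interior B := by
    intro D hD B hB h G hG
    have : G ∈ childrenIn (𝒜 (n + 1)) B := by
      rw [← hΩ B hB]
      exact mem_biUnion (show D ∈ {D | D ∈ 𝒜 n ∧ Arrow Φ D B} from ⟨hD, h⟩) hG
    exact this
  have hΓsub : ∀ D ∈ 𝒜 n, ∀ B ∈ 𝒜 n, ∀ C ∈ 𝒜 n, Arrow Φ D B → Arrow Φ B C →
      Γ D B C ⊆ Ω D B := by
    intro D hD B hB C hC h h' G hG
    rw [← hΓ D hD B hB h]
    exact mem_biUnion (show C ∈ {C | C ∈ 𝒜 n ∧ Arrow Φ B C} from ⟨hC, h'⟩) hG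
  have hΩuniq : ∀ D ∈ 𝒜 n, ∀ B ∈ 𝒜 n, Arrow Φ D B → ∀ D' ∈ 𝒜 n, ∀ B' ∈ 𝒜 n, Arrow Φ D' B' →
      ∀ G ∈ Ω D B, G ∈ Ω D' B' → D = D' ∧ B = B' := by
    intro D hD B hB h D' hD' B' hB' h' G hG hG'
    have h1 := hΩsub D hD B hB h G hG
    have h2 := hΩsub D' hD' B' hB' h' G hG'
    obtain ⟨x, hx⟩ := (hΦ.isBox _ G h1.1).nonempty
    obtain rfl := hΦ.eq_of_mem hB hB' (interior_subset (h1.2 hx)) (interior_subset (h2.2 hx))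
    refine ⟨?_, rfl⟩
    by_contra hne
    exact Set.disjoint_left.1 (hΩd B hB ⟨hD, h⟩ ⟨hD', h'⟩ hne) hG hG'
  have hex : ∀ g : {A // A ∈ 𝒜 (n + 1)}, ∃ d b c : {A // A ∈ 𝒜 n},
      Arrow Φ d.1 b.1 ∧ Arrow Φ b.1 c.1 ∧ g.1 ∈ Γ d.1 b.1 c.1 := by
    rintro ⟨G, hG⟩
    obtain ⟨B, hB, hGB⟩ := hgen.subset_parent G hG
    have h1 : G ∈ childrenIn (𝒜 (n + 1)) B := ⟨hG, hGB⟩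
    rw [← hΩ B hB] at h1
    obtain ⟨D, ⟨hD, hDB⟩, hGD⟩ := mem_iUnion₂.1 h1
    rw [← hΓ D hD B hB hDB] at hGD
    obtain ⟨C, ⟨hC, hBC⟩, hGC⟩ := mem_iUnion₂.1 hGD
    exact ⟨⟨D, hD⟩, ⟨B, hB⟩, ⟨C, hC⟩, hDB, hBC, hGC⟩
  choose prev par next hpp hpn hmem using hex
  have hmemΩ : ∀ g, g.1 ∈ Ω (prev g).1 (par g).1 := fun g =>
    hΓsub _ (prev g).2 _ (par g).2 _ (next g).2 (hpp g) (hpn g) (hmem g)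
  have hΩiff : ∀ (g) (d b : {A // A ∈ 𝒜 n}), Arrow Φ d.1 b.1 →
      (g.1 ∈ Ω d.1 b.1 ↔ d = prev g ∧ b = par g) := by
    intro g d b h
    constructor
    · intro hg
      have := hΩuniq _ d.2 _ b.2 h _ (prev g).2 _ (par g).2 (hpp g) _ hg (hmemΩ g)
      exact ⟨Subtype.ext this.1, Subtype.ext this.2⟩
    · rintro ⟨rfl, rfl⟩
      exact hmemΩ g
  have harrow : ∀ g e : {A // A ∈ 𝒜 (n + 1)}, Arrow Φ g.1 e.1 ↔ e.1 ∈ Ω (par g).1 (next g).1 := by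
    intro g e
    have h := hd _ (prev g).2 _ (par g).2 _ (next g).2 (hpp g) (hpn g) g.1 (hmem g)
    refine ⟨fun he => ?_, h.1 e.1⟩
    by_contra hne
    obtain ⟨x, hx, hxe⟩ := he
    exact Set.notMem_empty x (h.2 e.1 e.2 hne ▸ ⟨hx, interior_subset hxe⟩)
  refine ⟨prev, par, next, fun g => ?_, hpp, hpn, fun d b c hdb hbc => ?_, fun g e => ?_,
    fun g e he => ?_⟩
  · exact (hΩsub _ (prev g).2 _ (par g).2 (hpp g) _ (hmemΩ g)).2.trans interior_subset
  · rw [← hΓc _ d.2 _ b.2 _ c.2 hdb hbc, ← Set.ncard_image_of_injective _ Subtype.val_injective]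
    congr 1
    ext G
    constructor
    · rintro ⟨g, ⟨rfl, rfl, rfl⟩, rfl⟩
      exact hmem g
    · intro hG
      have hGΩ := hΓsub _ d.2 _ b.2 _ c.2 hdb hbc hG
      have hG𝒜 := (hΩsub _ d.2 _ b.2 hdb _ hGΩ).1
      obtain ⟨rfl, rfl⟩ := (hΩiff ⟨G, hG𝒜⟩ d b hdb).1 hGΩ
      refine ⟨⟨G, hG𝒜⟩, ⟨rfl, rfl, ?_⟩, rfl⟩
      by_contra hne
      have hne' : (next ⟨G, hG𝒜⟩).1 ≠ c.1 := fun h => hne (Subtype.ext h)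
      exact Set.disjoint_left.1 (hΓd _ (prev ⟨G, hG𝒜⟩).2 _ (par ⟨G, hG𝒜⟩).2 (hpp _)
        ⟨(next ⟨G, hG𝒜⟩).2, hpn _⟩ ⟨c.2, hbc⟩ hne') (hmem ⟨G, hG𝒜⟩) hG
  · rw [harrow, hΩiff e _ _ (hpn g)]
  · rw [harrow] at he
    exact (hd _ (prev g).2 _ (par g).2 _ (next g).2 (hpp g) (hpn g) g.1 (hmem g)).2 e.1 e.2 he

theorem exists_atomTower (hΦ : IsModelWith Φ 𝒜) :
    ∃ T : AtomTower Φ fun n => {A // A ∈ 𝒜 n},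
      ∀ (n : ℕ) (v : {A // A ∈ 𝒜 n}), T.cell v = v.1 := by
  choose prev par next hsub hpp hpn hcard hiff havoid using hΦ.exists_labels
  have hzero : ∃ r : {A // A ∈ 𝒜 0}, (∀ v, v = r) ∧ Arrow Φ r.1 r.1 := by
    obtain ⟨A, hA, hAA⟩ := hΦ.gen_zero
    exact ⟨⟨A, by simp [hA]⟩, fun v => Subtype.ext (by simpa [hA] using v.2), hAA⟩
  choose r hr hrr using hzero
  refine ⟨{
    cell := fun v => v.1
    rel := fun v w => Arrow Φ v.1 w.1
    prev := fun {n} => prev n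
    par := fun {n} => par n
    next := fun {n} => next n
    root := r
    eq_root := hr
    rel_root := hrr
    isClosed_cell := fun {n} v => (hΦ.isBox n _ v.2).1.isClosed
    nonempty_cell := fun {n} v => (hΦ.isBox n _ v.2).nonempty
    disjoint_cell := fun {n v w} h => hΦ.disjoint n _ v.2 _ w.2 fun h' => h (Subtype.ext h')
    cell_subset := fun {n} => hsub n
    rel_prev_par := fun {n} => hpp n
    rel_par_next := fun {n} => hpn n
    ncard_fiber := fun {n d b c} => hcard n d b c
    rel_iff := fun {n} => hiff n
    image_inter_nonempty := fun h => h.mono (inter_subset_inter_right _ interior_subset)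
    image_inter_eq_empty := ?_
    exists_dist_lt := ?_ }, fun _ _ => rfl⟩
  · rintro (_ | n) v w h
    · rw [hr v, hr w] at h
      exact absurd hrr h
    · exact havoid n v w h
  · intro ε hε
    obtain ⟨N, hN⟩ := eventually_atTop.1
      (hΦ.tendsto_diam.eventually_lt_const (ENNReal.ofReal_pos.2 hε))
    refine ⟨N, fun n hn v x hx y hy => ?_⟩
    have h1 : edist x y < ENNReal.ofReal ε :=
      (Metric.edist_le_ediam_of_mem hx hy).trans_lt
        ((le_iSup₂_of_le v.1 v.2 le_rfl).trans_lt (hN n hn))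
    rwa [edist_dist, ENNReal.ofReal_lt_ofReal_iff hε] at h1

end IsModelWith

theorem mainTheorem5 (m : ℕ) (hm : 2 ≤ m) (Φ : C(Cube m, Cube m))
    (𝒜 : ℕ → Finset (Set (Cube m))) (hΦ : IsModelWith Φ 𝒜) :
    IsCantorSet (lambdaSet 𝒜) ∧
    Φ '' lambdaSet 𝒜 = lambdaSet 𝒜 ∧
    ∃ ν : Measure (Cube m),
      IsProbabilityMeasure ν ∧
      MeasurePreserving Φ ν ν ∧
      IsMixing Φ ν ∧
      Ergodic Φ ν ∧
      ν (lambdaSet 𝒜)ᶜ = 0 ∧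
      metricEntropy Φ ν = ⊤ ∧
      ∀ n : ℕ,
        IsFinitePartition ν (atomPartition 𝒜 n) ∧
        Tendsto (fun l : ℕ => joinEntropy Φ ν (atomPartition 𝒜 n) l / (l : ℝ)) atTop
          (𝓝 ((n : ℝ) * Real.log 2)) ∧
        partitionEntropy Φ ν (atomPartition 𝒜 n) = (((n : ℝ) * Real.log 2 : ℝ) : EReal) := by
  obtain ⟨T, hT⟩ := hΦ.exists_atomTower
  have hΛ : lambdaSet 𝒜 = T.limitSet := by
    simp only [lambdaSet, AtomTower.limitSet, hT, iUnion_subtype]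
  have hP : ∀ n, atomPartition 𝒜 n = T.trace n := fun n => by
    funext v
    simp only [atomPartition, AtomTower.trace, hT, hΛ]
  obtain ⟨ν, hprob, hν⟩ := T.exists_isUniform
  simp only [hΛ, hP]
  exact ⟨T.isCantorSet_limitSet, T.image_limitSet, ν, hprob, hν.measurePreserving, hν.isMixing,
    hν.isMixing.ergodic hν.measurePreserving, hν.measure_compl_limitSet, hν.metricEntropy_eq_top,
    fun n => ⟨hν.isFinitePartition_trace n, hν.tendsto_joinEntropy_trace n,
      partitionEntropy_eq_of_tendsto (hν.tendsto_joinEntropy_trace n)⟩⟩
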